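/- Let $n,r,d,k$ be positive integers with $k\mid r$, $k\mid d$ and $n\equiv 0\pmod d$, and write $[n]=\{1,\dots,n\}$. **The Dowling lattice.** Put $G=\mathbb{Z}/r\mathbb{Z}$. A $G$-prepartition of $[n]$ is a triple $(I,\pi,\gamma)$, where $I\subseteq[n]$ (the zero block, possibly empty), $\pi=\{B_1,\dots,B_m\}$ is a partition of $[n]\setminus I$ into nonempty blocks, and $\gamma:[n]\setminus I\to G$ is a map. Each nonzero block $(B_i,\gamma|_{B_i})$ is regarded as the subset $\{(a,\gamma(a)) : a\in B_i\}$ of $[n]\times G$, and $G$ acts on such subsets by translating the second coordinate. Two $G$-prepartitions are equivalent if they have the same zero block and there is a bijection between their nonzero blocks such that corresponding blocks lie in the same $G$-orbit; the equivalence classes $\overline{(I,\pi,\gamma)}$ are the $G$-partitions. The Dowling lattice $Q_n(r)$ is the set of all $G$-partitions, with the partial order generated by merging two blocks: either a nonzero block $B$ is absorbed into the zero block, or two nonzero blocks $(B,\gamma|_B)$ and $(C,\gamma|_C)$ are replaced by $(B,\gamma|_B)\cup\big((C,\gamma|_C)+g\big)$ for some $g\in G$. Its minimum $\hat 0$ has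 $I=\emptyset$ and all blocks of $\pi$ singletons. Write $|\pi|$ for the number of blocks of $\pi$. **The subposet.** Let $Q_n(r,d,k,\{0\})$ be the subposet of $Q_n(r)$, with the induced order, consisting of $\hat 0$ together with all $\overline{(I,\pi,\gamma)}$ such that $I\neq\emptyset$, every block of $\pi$ has cardinality divisible by $d$, and for every block $B$ of $\pi$ the number of $a\in B$ with $\gamma(a)\equiv j\pmod k$ does not depend on $j\in\mathbb{Z}/k\mathbb{Z}$. **Recursive atom orderings.** A finite bounded poset $P$, with minimum $\hat 0$ and maximum $\hat 1$, admits a recursive atom ordering if its length is $1$, or if its length is greater than $1$ and its atoms can be ordered $a_1,\dots,a_t$ so that: (i) for every $j$ the interval $[a_j,\hat 1]$ admits a recursive atom ordering in which the atoms of $[a_j,\hat 1]$ that belong to $[a_i,\hat 1]$ for some $i<j$ come first; and (ii) for all $i<j$ and all $y\in P$ with $a_i,a_j<y$ there are $l<j$ and an atom $z$ of $[a_j,\hat 1]$ with $a_l<z\le y$. **Proposition.** The poset $Q_n(r,d,k,\{0\})$ is a lattice, it is pure (all its maximal chains have the same length), and it is bounded and admits a recursive atom ordering. Its rank function (the length of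 the interval from $\hat 0$ to the given element) is $$\operatorname{rk}\big(\overline{(I,\pi,\gamma)}\big)=\begin{cases}0,&\text{if }\overline{(I,\pi,\gamma)}=\hat 0,\\ \lfloor n/d\rfloor-|\pi|,&\text{otherwise.}\end{cases}$$ -/

import Mathlib

/-! ### Dowling lattices

`[n]` is `Fin n`, and the group `G` is written additively; it is specialised to `ZMod r` below. -/

namespace Dowling

/-- A `G`-prepartition `(I, π, γ)` of `[n]`: a zero block `I`, a partition `π` of `[n] \ I` into
nonempty blocks, and a labelling `γ`. Only the labels of elements outside `I` carry information:
the values of `label` on `zero` are ignored by the equivalence relation below. -/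
structure GPrepartition (n : ℕ) (G : Type*) where
  zero : Finset (Fin n)
  part : Finpartition zeroᶜ
  label : Fin n → G

/-- The right action of `G` on the subsets of `[n] × G`. -/
def translate {n : ℕ} {G : Type*} [AddGroup G] (S : Set (Fin n × G)) (g : G) :
    Set (Fin n × G) :=
  (fun p => (p.1, p.2 + g)) '' S

namespace GPrepartition

variable {n : ℕ} {G : Type*}

/-- The nonzero block `(B, γ|_B)`, as the subset `{(a, γ a) | a ∈ B}` of `[n] × G`. -/
def block (X : GPrepartition n G) (B : Finset (Fin n)) : Set (Fin n × G) :=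
  {p | p.1 ∈ B ∧ p.2 = X.label p.1}

theorem fst_block (X : GPrepartition n G) (B : Finset (Fin n)) :
    Prod.fst '' X.block B = (B : Set (Fin n)) := by
  ext a
  simp [block]

variable [AddGroup G]

/-- Two prepartitions are equivalent if their zero blocks are equal and there is a bijection between
their nonzero blocks such that corresponding blocks lie in the same `G`-orbit. -/
def Equivalent (X Y : GPrepartition n G) : Prop :=
  X.zero = Y.zero ∧ ∃ e : {B // B ∈ X.part.parts} ≃ {B // B ∈ Y.part.parts},
    ∀ B, ∃ g : G, Y.block (e B).1 = translate (X.block B.1) g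

theorem translate_zero (S : Set (Fin n × G)) : translate S 0 = S := by
  simp [translate]

theorem translate_translate (S : Set (Fin n × G)) (g h : G) :
    translate (translate S g) h = translate S (g + h) := by
  simp [translate, Set.image_image, add_assoc]

theorem fst_translate (S : Set (Fin n × G)) (g : G) :
    Prod.fst '' translate S g = Prod.fst '' S := by
  simp [translate, Set.image_image]

instance setoid (n : ℕ) (G : Type*) [AddGroup G] : Setoid (GPrepartition n G) where
  r := Equivalent
  iseqv := by
    refine ⟨fun X => ⟨rfl, Equiv.refl _, fun B => ⟨0, by simp [translate_zero]⟩⟩, ?_, ?_⟩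
    · rintro X Y ⟨h, e, he⟩
      refine ⟨h.symm, e.symm, fun B => ?_⟩
      obtain ⟨g, hg⟩ := he (e.symm B)
      refine ⟨-g, ?_⟩
      rw [Equiv.apply_symm_apply] at hg
      rw [hg, translate_translate, add_neg_cancel, translate_zero]
    · rintro X Y Z ⟨h, e, he⟩ ⟨h', e', he'⟩
      refine ⟨h.trans h', e.trans e', fun B => ?_⟩
      obtain ⟨g, hg⟩ := he B
      obtain ⟨g', hg'⟩ := he' (e B)
      exact ⟨g + g', by rw [Equiv.trans_apply, hg', hg, translate_translate]⟩

theorem parts_eq_of_equivalent {X Y : GPrepartition n G} (h : X ≈ Y) :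
    X.part.parts = Y.part.parts := by
  obtain ⟨-, e, he⟩ := h
  have key : ∀ B, (e B).1 = B.1 := fun B => by
    obtain ⟨g, hg⟩ := he B
    have := congrArg (Prod.fst '' ·) hg
    simp only [fst_translate, fst_block] at this
    exact_mod_cast this
  ext B
  constructor
  · intro hB
    have := (e ⟨B, hB⟩).2
    rwa [key] at this
  · intro hB
    have := key (e.symm ⟨B, hB⟩)
    rw [Equiv.apply_symm_apply] at this
    change B = _ at this
    rw [this]
    exact (e.symm ⟨B, hB⟩).2

/-- `Y` arises from `X` by merging the zero block with a nonzero block `B`. -/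
def MergeZero (X Y : GPrepartition n G) : Prop :=
  ∃ B ∈ X.part.parts,
    Y.zero = X.zero ∪ B ∧ Y.part.parts = X.part.parts.erase B ∧
      ∀ a ∉ Y.zero, Y.label a = X.label a

/-- `Y` arises from `X` by merging two nonzero blocks `(B, γ_B)` and `(C, γ_C)` into
`(B, γ_B) ∪ (C, γ_C) · g`, for some `g` in `G`. -/
def MergeNonzero (X Y : GPrepartition n G) : Prop :=
  ∃ B ∈ X.part.parts, ∃ C ∈ X.part.parts, B ≠ C ∧ ∃ g : G,
    Y.zero = X.zero ∧
      Y.part.parts = insert (B ∪ C) ((X.part.parts.erase B).erase C) ∧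
      ∀ a ∉ Y.zero, Y.label a = if a ∈ C then X.label a + g else X.label a

end GPrepartition

/-- The Dowling lattice `Q_n(G)`: the type of `G`-partitions of `[n]`, that is, of equivalence
classes of `G`-prepartitions. -/
def GPartition (n : ℕ) (G : Type*) [AddGroup G] : Type _ :=
  Quotient (GPrepartition.setoid n G)

namespace GPartition

variable {n : ℕ} {G : Type*} [AddGroup G]

/-- The `G`-partition of a prepartition. -/
def mk (X : GPrepartition n G) : GPartition n G := Quotient.mk _ X

/-- The zero block `I`. -/
def zero (x : GPartition n G) : Finset (Fin n) :=
  Quotient.lift GPrepartition.zero (fun X Y (h : GPrepartition.Equivalent X Y) => h.1) x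

/-- The set of (underlying sets of) nonzero blocks, i.e. the partition `π`. -/
def parts (x : GPartition n G) : Finset (Finset (Fin n)) :=
  Quotient.lift (fun X : GPrepartition n G => X.part.parts)
    (fun _ _ h => GPrepartition.parts_eq_of_equivalent h) x

/-- `y` is obtained from `x` by merging two `G`-blocks of `x`. -/
def Merge (x y : GPartition n G) : Prop :=
  ∃ X Y : GPrepartition n G, mk X = x ∧ mk Y = y ∧ (X.MergeZero Y ∨ X.MergeNonzero Y)

theorem Merge.card_lt {x y : GPartition n G} (h : Merge x y) :
    y.parts.card < x.parts.card := by
  obtain ⟨X, Y, rfl, rfl, ⟨B, hB, -, h, -⟩ | ⟨B, hB, C, hC, hne, g, -, h, -⟩⟩ := h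
  · change Y.part.parts.card < X.part.parts.card
    rw [h]
    exact Finset.card_erase_lt_of_mem hB
  · change Y.part.parts.card < X.part.parts.card
    rw [h]
    have h1 := Finset.card_insert_le (B ∪ C) ((X.part.parts.erase B).erase C)
    have h2 := Finset.card_erase_lt_of_mem hB
    have h3 := Finset.card_erase_lt_of_mem (Finset.mem_erase.2 ⟨hne.symm, hC⟩)
    omega

theorem eq_or_card_lt {x y : GPartition n G} (h : Relation.ReflTransGen Merge x y) :
    x = y ∨ y.parts.card < x.parts.card := by
  induction h with
  | refl => exact Or.inl rfl
  | tail _ h ih =>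
    right
    rcases ih with rfl | ih
    · exact h.card_lt
    · exact h.card_lt.trans ih

/-- The partial order generated by merging blocks. -/
instance : PartialOrder (GPartition n G) where
  le := Relation.ReflTransGen Merge
  le_refl _ := Relation.ReflTransGen.refl
  le_trans _ _ _ := Relation.ReflTransGen.trans
  le_antisymm x y h h' := by
    rcases eq_or_card_lt h with h | h
    · exact h
    · rcases eq_or_card_lt h' with h' | h'
      · exact h'.symm
      · omega

/-- The element `0̂` of `Q_n(G)`: the zero block is empty and all other blocks are singletons. -/
def zeroHat (n : ℕ) (G : Type*) [AddGroup G] : GPartition n G :=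
  mk ⟨∅, ⊥, fun _ => 0⟩

/-- All nonzero blocks have length divisible by `d`. -/
def IsDivisible (d : ℕ) (x : GPartition n G) : Prop :=
  ∀ B ∈ x.parts, d ∣ B.card

/-- For each nonzero block `(B, γ)`, the number of `a ∈ B` with `γ a ≡ j (mod k)` does not depend
on `j`. For `k ∣ r` the condition on a prepartition does not depend on the choice of the
representative. -/
def IsEvenlyColoured {r : ℕ} (k : ℕ) (x : GPartition n (ZMod r)) : Prop :=
  ∀ X : GPrepartition n (ZMod r), mk X = x → ∀ B ∈ X.part.parts, ∀ i j : ZMod k,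
    (B.filter fun a => (X.label a).cast = i).card = (B.filter fun a => (X.label a).cast = j).card

end GPartition

open GPartition in
/-- `Q_n(r, d)`, as a subset of `Q_n(r) = Q_n(ℤ/r)`. -/
def Qnrd (n r d : ℕ) : Set (GPartition n (ZMod r)) :=
  {x | x.IsDivisible d ∨ x = zeroHat n (ZMod r)}

open GPartition in
/-- `Q_n(r, d, k)`, as a subset of `Q_n(r)`. -/
def Qnrdk (n r d k : ℕ) : Set (GPartition n (ZMod r)) :=
  {x | (x ∈ Qnrd n r d ∧ x.IsEvenlyColoured k) ∨ x = zeroHat n (ZMod r)}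

open GPartition in
/-- `Q_n(r, d, k, J)`, as a subset of `Q_n(r)`; it carries the induced partial order. -/
def QnrdkJ (n r d k : ℕ) (J : Set ℕ) : Set (GPartition n (ZMod r)) :=
  {x | (x ∈ Qnrdk n r d k ∧ x.zero.card ∉ J) ∨ x = zeroHat n (ZMod r)}

/-! ### Posets -/

/-- Any two elements have a join and a meet. -/
def IsLatticeOrder (P : Type*) [PartialOrder P] : Prop :=
  ∀ x y : P, (∃ z, IsLUB {x, y} z) ∧ ∃ z, IsGLB {x, y} z

/-- All maximal chains have the same length. -/
def IsPure (P : Type*) [PartialOrder P] : Prop :=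
  ∀ s t : Set P, IsMaxChain (· ≤ ·) s → IsMaxChain (· ≤ ·) t → s.encard = t.encard

/-- `IsRecursiveAtomOrdering x l`: the list `l` is a recursive atom ordering of the interval
`[x, ⊤]`. The atoms of this interval are the elements covering `x`, and an interval `[a, ⊤]` of
`[x, ⊤]` is an interval of the same kind in `P`. The constructor `base` is the case of length one,
`step` that of length greater than one. -/
inductive IsRecursiveAtomOrdering {P : Type*} [PartialOrder P] [BoundedOrder P] :
    P → List P → Prop
  | base (x : P) (hx : x ⋖ ⊤) : IsRecursiveAtomOrdering x [⊤]
  | step (x : P) (l : List P) (hx : x < ⊤) (hx' : ¬ x ⋖ ⊤)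
      (nodup : l.Nodup) (mem_iff : ∀ a, a ∈ l ↔ x ⋖ a)
      (L : Fin l.length → List P)
      (recursive : ∀ j, IsRecursiveAtomOrdering (l.get j) (L j))
      (first : ∀ j, ∀ p q : Fin (L j).length,
        (∃ i < j, l.get i ≤ (L j).get p) → (¬ ∃ i < j, l.get i ≤ (L j).get q) → p < q)
      (exchange : ∀ i j, i < j → ∀ y, l.get i < y → l.get j < y →
        ∃ k < j, ∃ z, l.get j ⋖ z ∧ l.get k < z ∧ z ≤ y) :
      IsRecursiveAtomOrdering x l

/-- `P` is a bounded poset that admits a recursive atom ordering. -/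
def AdmitsRecursiveAtomOrdering (P : Type*) [PartialOrder P] : Prop :=
  ∃ _ : BoundedOrder P, ∃ l : List P, IsRecursiveAtomOrdering ⊥ l

end Dowling

/-! A `G`-partition is encoded by its edges: the elements of its zero block, and the gains `γ a - γ
b` of pairs in a common block (every gain occurs inside the zero block). The order is then inclusion
of edge sets, and a missing edge can be adjoined to `x` by a single merge, whose result is the least
element above `x` containing that edge (`exists_merge_of_notMem_edges`). As for the flats of a
matroid, this gives joins and semimodularity in the Dowling lattice.

Merging preserves divisibility and balance, so the elements of the subposet other than `0̂` form an
upper set. Joins are therefore inherited, and a finite poset with joins and a minimum is a lattice.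
Above any element other than `0̂` the poset is semimodular, and there the atoms may be ordered
arbitrarily. Since `d ∣ n`, the zero block also has size divisible by `d`. An element with a block
larger than `d` arises from another good element by a merge, so the atoms are the elements all of
whose blocks, the zero block included, have size `d`. This gives the rank function and purity.

It remains to order the atoms of the whole poset. They are sorted by decreasing `key`: first the sum
of the squares of the block sums, then an injective enumeration of the gains of the blocks. It is
enough that below each `y` only one atom is a local maximum, meaning that no atom below a cover of
it in `[a, y]` has a larger key. At a local maximum a swap of two elements cannot increase the sum
of squares. Hence the blocks inside the zero block of `y` are consecutive intervals with the zero
block first, and those inside a nonzero block of `y` are consecutive colour by colour. Such a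
partition is unique. The labels inside a nonzero block of `y` are dictated by `y`; those inside its
zero block are fixed by the second component of the key, block by block. -/

namespace Dowling

/-! ### Merging, refinement and edges of prepartitions -/

namespace GPrepartition

variable {n : ℕ} {G : Type*}

theorem notMem_zero_of_mem (X : GPrepartition n G) {B : Finset (Fin n)} (hB : B ∈ X.part.parts)
    {a : Fin n} (ha : a ∈ B) : a ∉ X.zero :=
  Finset.mem_compl.1 (X.part.subset hB ha)

theorem exists_mem_parts (X : GPrepartition n G) {a : Fin n} (ha : a ∉ X.zero) :
    ∃ B ∈ X.part.parts, a ∈ B :=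
  X.part.exists_mem (Finset.mem_compl.2 ha)

theorem disjoint_parts (X : GPrepartition n G) {B C : Finset (Fin n)} (hB : B ∈ X.part.parts)
    (hC : C ∈ X.part.parts) (h : B ≠ C) : Disjoint B C :=
  X.part.disjoint hB hC h

theorem disjoint_zero (X : GPrepartition n G) {B : Finset (Fin n)} (hB : B ∈ X.part.parts) :
    Disjoint X.zero B :=
  Finset.disjoint_right.2 fun _ ha => X.notMem_zero_of_mem hB ha

/-- The prepartition with zero block `Z`, set of nonzero blocks `P` and labelling `l`. -/
def ofParts (Z : Finset (Fin n)) (P : Finset (Finset (Fin n))) (l : Fin n → G)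
    (hZ : ∀ a, a ∈ Z ↔ ∀ B ∈ P, a ∉ B)
    (hP : ∀ B ∈ P, ∀ C ∈ P, ∀ a, a ∈ B → a ∈ C → B = C) (hne : ∅ ∉ P) : GPrepartition n G where
  zero := Z
  part := Finpartition.ofExistsUnique P
    (fun B hB a ha => Finset.mem_compl.2 fun h => (hZ a).1 h B hB ha)
    (fun a ha => by
      rw [Finset.mem_compl, hZ] at ha
      push Not at ha
      obtain ⟨B, hB, haB⟩ := ha
      exact ⟨B, ⟨hB, haB⟩, fun C hC => hP C hC.1 B hB a hC.2 haB⟩) hne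
  label := l

/-- Merging the zero block with the nonzero block `B`. -/
def mergeZero (X : GPrepartition n G) (B : Finset (Fin n)) (hB : B ∈ X.part.parts) :
    GPrepartition n G :=
  ofParts (X.zero ∪ B) (X.part.parts.erase B) X.label
    (fun a => by
      rw [Finset.mem_union]
      constructor
      · rintro (h | h) C hC haC
        · exact X.notMem_zero_of_mem (Finset.mem_of_mem_erase hC) haC h
        · exact Finset.ne_of_mem_erase hC
            (X.part.eq_of_mem_parts (Finset.mem_of_mem_erase hC) hB haC h)
      · intro h
        by_contra! h'
        obtain ⟨C, hC, haC⟩ := X.exists_mem_parts h'.1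
        exact h C (Finset.mem_erase.2 ⟨fun e => h'.2 (e ▸ haC), hC⟩) haC)
    (fun C hC D hD a ha ha' => X.part.eq_of_mem_parts (Finset.mem_of_mem_erase hC)
      (Finset.mem_of_mem_erase hD) ha ha')
    (fun h => X.part.empty_notMem_parts (Finset.mem_of_mem_erase h))

/-- Merging the nonzero blocks `B` and `C`, the labels of `C` being translated by `g`. -/
def mergeNonzero [Add G] (X : GPrepartition n G) (B C : Finset (Fin n)) (hB : B ∈ X.part.parts)
    (hC : C ∈ X.part.parts) (g : G) : GPrepartition n G :=
  ofParts X.zero (insert (B ∪ C) ((X.part.parts.erase B).erase C))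
    (fun a => if a ∈ C then X.label a + g else X.label a)
    (fun a => by
      constructor
      · rintro h D hD haD
        rcases Finset.mem_insert.1 hD with rfl | hD
        · rcases Finset.mem_union.1 haD with h' | h'
          · exact X.notMem_zero_of_mem hB h' h
          · exact X.notMem_zero_of_mem hC h' h
        · exact X.notMem_zero_of_mem (Finset.mem_of_mem_erase (Finset.mem_of_mem_erase hD)) haD h
      · intro h
        by_contra h'
        obtain ⟨D, hD, haD⟩ := X.exists_mem_parts h'
        have h1 := h _ (Finset.mem_insert_self _ _)
        rw [Finset.mem_union, not_or] at h1
        exact h D (Finset.mem_insert_of_mem (Finset.mem_erase.2 ⟨fun e => h1.2 (e ▸ haD),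
          Finset.mem_erase.2 ⟨fun e => h1.1 (e ▸ haD), hD⟩⟩)) haD)
    (by
      have key : ∀ D ∈ (X.part.parts.erase B).erase C, ∀ a ∈ D, a ∉ B ∪ C := by
        intro D hD a haD h
        simp only [Finset.mem_erase] at hD
        rcases Finset.mem_union.1 h with h | h
        · exact hD.2.1 (X.part.eq_of_mem_parts hD.2.2 hB haD h)
        · exact hD.1 (X.part.eq_of_mem_parts hD.2.2 hC haD h)
      intro D hD E hE a ha ha'
      rcases Finset.mem_insert.1 hD with rfl | hD <;> rcases Finset.mem_insert.1 hE with rfl | hE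
      · rfl
      · exact absurd ha (key E hE a ha')
      · exact absurd ha' (key D hD a ha)
      · exact X.part.eq_of_mem_parts (Finset.mem_of_mem_erase (Finset.mem_of_mem_erase hD))
          (Finset.mem_of_mem_erase (Finset.mem_of_mem_erase hE)) ha ha')
    (fun h => by
      rcases Finset.mem_insert.1 h with h | h
      · obtain ⟨a, ha⟩ := X.part.nonempty_of_mem_parts hB
        exact Finset.notMem_empty a (h ▸ Finset.mem_union_left _ ha)
      · exact X.part.empty_notMem_parts (Finset.mem_of_mem_erase (Finset.mem_of_mem_erase h)))

theorem mergeZero_mergeZero (X : GPrepartition n G) (B : Finset (Fin n))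
    (hB : B ∈ X.part.parts) : X.MergeZero (X.mergeZero B hB) :=
  ⟨B, hB, rfl, rfl, fun _ _ => rfl⟩

variable [AddGroup G]

theorem mergeNonzero_mergeNonzero (X : GPrepartition n G) (B C : Finset (Fin n))
    (hB : B ∈ X.part.parts) (hC : C ∈ X.part.parts) (h : B ≠ C) (g : G) :
    X.MergeNonzero (X.mergeNonzero B C hB hC g) :=
  ⟨B, hB, C, hC, h, g, rfl, rfl, fun _ _ => rfl⟩

/-- Every block of `X` is contained in a block of `Y`, compatibly with the labels. -/
def Refines (X Y : GPrepartition n G) : Prop :=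
  X.zero ⊆ Y.zero ∧ ∀ B ∈ X.part.parts, B ⊆ Y.zero ∨
    ∃ C ∈ Y.part.parts, B ⊆ C ∧ ∃ g, ∀ a ∈ B, Y.label a = X.label a + g

/-- The elements of the zero block, and the gains `(a, b, γ a - γ b)` of pairs in a common block;
all gains occur in the zero block. -/
def edges (X : GPrepartition n G) : Set (Fin n ⊕ Fin n × Fin n × G) :=
  {e | Sum.elim (· ∈ X.zero) (fun p => (p.1 ∈ X.zero ∧ p.2.1 ∈ X.zero) ∨
    ∃ B ∈ X.part.parts, p.1 ∈ B ∧ p.2.1 ∈ B ∧ X.label p.1 - X.label p.2.1 = p.2.2) e}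

theorem inr_mem_edges (X : GPrepartition n G) (a b : Fin n) (g : G) :
    Sum.inr (a, b, g) ∈ X.edges ↔ (a ∈ X.zero ∧ b ∈ X.zero) ∨
      ∃ B ∈ X.part.parts, a ∈ B ∧ b ∈ B ∧ X.label a - X.label b = g :=
  Iff.rfl

/-- For a block `B` with base point `b`, the gains of the pairs `(a, b)` already determine where `Y`
puts `B` and by which translation. -/
theorem refines_iff_edges_subset {X Y : GPrepartition n G} :
    X.Refines Y ↔ X.edges ⊆ Y.edges := by
  constructor
  · rintro ⟨h0, h⟩ (a | ⟨a, b, g⟩) he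
    · exact h0 he
    · rw [inr_mem_edges] at he ⊢
      rcases he with ⟨ha, hb⟩ | ⟨B, hB, ha, hb, rfl⟩
      · exact Or.inl ⟨h0 ha, h0 hb⟩
      · rcases h B hB with h | ⟨C, hC, hBC, g, hg⟩
        · exact Or.inl ⟨h ha, h hb⟩
        · exact Or.inr ⟨C, hC, hBC ha, hBC hb, by
            rw [hg a ha, hg b hb, add_sub_add_right_eq_sub]⟩
  · intro h
    refine ⟨fun a ha => h (a := Sum.inl a) ha, fun B hB => ?_⟩
    obtain ⟨b, hb⟩ := X.part.nonempty_of_mem_parts hB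
    have key : ∀ a ∈ B, Sum.inr (a, b, X.label a - X.label b) ∈ Y.edges := fun a ha =>
      h ((inr_mem_edges ..).2 (Or.inr ⟨B, hB, ha, hb, rfl⟩))
    by_cases hbY : b ∈ Y.zero
    · left
      intro a ha
      rcases (inr_mem_edges ..).1 (key a ha) with h1 | ⟨C, hC, -, h1, -⟩
      · exact h1.1
      · exact absurd hbY (Y.notMem_zero_of_mem hC h1)
    · right
      obtain ⟨C, hC, hbC⟩ := Y.exists_mem_parts hbY
      have key' : ∀ a ∈ B, a ∈ C ∧ Y.label a - Y.label b = X.label a - X.label b := by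
        intro a ha
        rcases (inr_mem_edges ..).1 (key a ha) with h1 | ⟨D, hD, h1, h2, h3⟩
        · exact absurd h1.2 hbY
        · exact ⟨Y.part.eq_of_mem_parts hD hC h2 hbC ▸ h1, h3⟩
      -- The translation is forced by the case `a = b`; `G` need not be commutative, so the order of
      -- the summands matters.
      refine ⟨C, hC, fun a ha => (key' a ha).1, -X.label b + Y.label b, fun a ha => ?_⟩
      rw [← add_assoc, ← sub_eq_add_neg, ← (key' a ha).2, sub_add_cancel]

theorem Refines.trans {X Y Z : GPrepartition n G} (h : X.Refines Y) (h' : Y.Refines Z) :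
    X.Refines Z :=
  refines_iff_edges_subset.2 ((refines_iff_edges_subset.1 h).trans (refines_iff_edges_subset.1 h'))

theorem block_eq_translate_iff {X Y : GPrepartition n G} {B C : Finset (Fin n)} {g : G} :
    Y.block C = translate (X.block B) g ↔ C = B ∧ ∀ a ∈ B, Y.label a = X.label a + g := by
  constructor
  · intro h
    have hCB : C = B := by
      have := congrArg (Prod.fst '' ·) h
      simp only [fst_translate, fst_block] at this
      exact_mod_cast this
    subst hCB
    refine ⟨rfl, fun a ha => ?_⟩
    have : (a, X.label a + g) ∈ Y.block C := by
      rw [h]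
      exact ⟨(a, X.label a), ⟨ha, rfl⟩, rfl⟩
    exact this.2.symm
  · rintro ⟨rfl, h⟩
    ext ⟨a, x⟩
    constructor
    · rintro ⟨ha, hx⟩
      exact ⟨(a, X.label a), ⟨ha, rfl⟩, Prod.ext rfl (by rw [hx, h a ha])⟩
    · rintro ⟨⟨b, z⟩, ⟨hb, hz⟩, he⟩
      simp only [Prod.mk.injEq] at he hb hz
      obtain ⟨rfl, rfl⟩ := he
      exact ⟨hb, by simp only [hz]; exact (h b hb).symm⟩

theorem parts_subset_of_refines {X Y : GPrepartition n G} (h : X.Refines Y) (h' : Y.Refines X)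
    {B : Finset (Fin n)} (hB : B ∈ X.part.parts) :
    B ∈ Y.part.parts ∧ ∃ g, ∀ a ∈ B, Y.label a = X.label a + g := by
  obtain ⟨b, hb⟩ := X.part.nonempty_of_mem_parts hB
  have hbX := X.notMem_zero_of_mem hB hb
  rcases h.2 B hB with h1 | ⟨C, hC, hBC, g, hg⟩
  · exact absurd (h'.1 (h1 hb)) hbX
  · rcases h'.2 C hC with h1 | ⟨D, hD, hCD, -⟩
    · exact absurd (h1 (hBC hb)) hbX
    · have : D = B := X.part.eq_of_mem_parts hD hB (hCD (hBC hb)) hb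
      subst this
      rw [hBC.antisymm hCD] at *
      exact ⟨hC, g, hg⟩

theorem equiv_iff_refines {X Y : GPrepartition n G} : X ≈ Y ↔ X.Refines Y ∧ Y.Refines X := by
  constructor
  · have key : ∀ X Y : GPrepartition n G, X ≈ Y → X.Refines Y := by
      rintro X Y ⟨h, e, he⟩
      refine ⟨h.subset, fun B hB => Or.inr ⟨e ⟨B, hB⟩, (e ⟨B, hB⟩).2, ?_⟩⟩
      obtain ⟨g, hg⟩ := he ⟨B, hB⟩
      rw [block_eq_translate_iff] at hg
      exact ⟨hg.1.symm.subset, g, hg.2⟩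
    exact fun h => ⟨key X Y h, key Y X (Setoid.symm h)⟩
  · rintro ⟨h, h'⟩
    refine ⟨h.1.antisymm h'.1, Equiv.subtypeEquivRight fun B =>
      ⟨fun hB => (parts_subset_of_refines h h' hB).1,
        fun hB => (parts_subset_of_refines h' h hB).1⟩, fun B => ?_⟩
    obtain ⟨g, hg⟩ := (parts_subset_of_refines h h' B.2).2
    exact ⟨g, block_eq_translate_iff.2 ⟨rfl, hg⟩⟩

theorem MergeZero.refines {X Y : GPrepartition n G} (h : X.MergeZero Y) : X.Refines Y := by
  obtain ⟨B, hB, h0, hp, hl⟩ := h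
  refine ⟨h0 ▸ Finset.subset_union_left, fun C hC => ?_⟩
  by_cases hCB : C = B
  · left
    rw [h0, hCB]
    exact Finset.subset_union_right
  · right
    have hCY : C ∈ Y.part.parts := hp ▸ Finset.mem_erase.2 ⟨hCB, hC⟩
    exact ⟨C, hCY, subset_rfl, 0, fun a ha => by
      rw [add_zero, hl a (Y.notMem_zero_of_mem hCY ha)]⟩

theorem MergeNonzero.refines {X Y : GPrepartition n G} (h : X.MergeNonzero Y) : X.Refines Y := by
  obtain ⟨B, hB, C, hC, hBC, g, h0, hp, hl⟩ := h
  refine ⟨h0.symm.subset, fun D hD => Or.inr ?_⟩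
  have hBC' : B ∪ C ∈ Y.part.parts := hp ▸ Finset.mem_insert_self _ _
  have hdis := Finset.disjoint_left.1 (X.disjoint_parts hB hC hBC)
  by_cases hDC : D = C
  · subst hDC
    refine ⟨_, hBC', Finset.subset_union_right, g, fun a ha => ?_⟩
    rw [hl a (h0 ▸ X.notMem_zero_of_mem hC ha), if_pos ha]
  · have hl' : ∀ a ∈ D, Y.label a = X.label a + 0 := fun a ha => by
      rw [hl a (h0 ▸ X.notMem_zero_of_mem hD ha), if_neg, add_zero]
      exact fun h => hDC (X.part.eq_of_mem_parts hD hC ha h)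
    by_cases hDB : D = B
    · subst hDB
      exact ⟨_, hBC', Finset.subset_union_left, 0, hl'⟩
    · exact ⟨D, hp ▸ Finset.mem_insert_of_mem (Finset.mem_erase.2 ⟨hDC, Finset.mem_erase.2
        ⟨hDB, hD⟩⟩), subset_rfl, 0, hl'⟩

theorem mergeZero_refines {X Y : GPrepartition n G} (h : X.Refines Y) {B : Finset (Fin n)}
    (hB : B ∈ X.part.parts) (hBY : B ⊆ Y.zero) : (X.mergeZero B hB).Refines Y :=
  ⟨Finset.union_subset h.1 hBY, fun C hC => h.2 C (Finset.mem_of_mem_erase hC)⟩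

/-- One gain between `B` and `C` is enough: on each of the two blocks the labels of `Y` are already
a translate of those of `X`, so the pair `(b, c)` fixes the relative translation. -/
theorem mergeNonzero_refines {X Y : GPrepartition n G} (h : X.Refines Y) {B C : Finset (Fin n)}
    (hB : B ∈ X.part.parts) (hC : C ∈ X.part.parts) (hBC : B ≠ C) {g : G}
    (h' : B ∪ C ⊆ Y.zero ∨ ∃ D ∈ Y.part.parts, ∃ b ∈ B, b ∈ D ∧ ∃ c ∈ C, c ∈ D ∧
      Y.label b - Y.label c = X.label b - (X.label c + g)) :
    (X.mergeNonzero B C hB hC g).Refines Y := by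
  have hdis := Finset.disjoint_left.1 (X.disjoint_parts hB hC hBC)
  refine ⟨h.1, fun E hE => ?_⟩
  rcases Finset.mem_insert.1 hE with rfl | hE'
  · refine h'.imp id ?_
    rintro ⟨D, hD, b, hb, hbD, c, hc, hcD, hbc⟩
    have key : ∀ E ∈ X.part.parts, ∀ e ∈ E, e ∈ D → E ⊆ D ∧
        ∀ a ∈ E, Y.label a = X.label a + (-X.label e + Y.label e) := by
      intro E hE e he heD
      rcases h.2 E hE with h1 | ⟨F, hF, hEF, g, hg⟩
      · exact absurd (h1 he) (Y.notMem_zero_of_mem hD heD)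
      · have : F = D := Y.part.eq_of_mem_parts hF hD (hEF he) heD
        subst this
        exact ⟨hEF, fun a ha => by rw [hg a ha, hg e he, neg_add_cancel_left]⟩
    obtain ⟨hBD, hb'⟩ := key B hB b hb hbD
    obtain ⟨hCD, hc'⟩ := key C hC c hc hcD
    refine ⟨D, hD, Finset.union_subset hBD hCD, -X.label b + Y.label b, fun a ha => ?_⟩
    change _ = (if a ∈ C then _ else _) + _
    split_ifs with haC
    · rw [hc' a haC, add_assoc, add_right_inj, neg_add_eq_iff_eq_add, ← add_assoc, ← add_assoc,
        ← sub_add_cancel (Y.label b) (Y.label c), hbc, sub_eq_add_neg, ← add_assoc, neg_add_rev]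
      simp [add_assoc]
    · exact hb' a ((Finset.mem_union.1 ha).resolve_right haC)
  · simp only [Finset.mem_erase] at hE'
    rcases h.2 E hE'.2.2 with h1 | ⟨D, hD, hED, g', hg'⟩
    · exact Or.inl h1
    · refine Or.inr ⟨D, hD, hED, g', fun a ha => ?_⟩
      change _ = (if a ∈ C then _ else _) + _
      rw [if_neg fun haC => hE'.1 (X.part.eq_of_mem_parts hE'.2.2 hC ha haC), hg' a ha]

theorem subset_zero_of_refines {X Y : GPrepartition n G} (h : X.Refines Y) {B : Finset (Fin n)}
    (hB : B ∈ X.part.parts) {b : Fin n} (hb : b ∈ B) (hbY : b ∈ Y.zero) : B ⊆ Y.zero := by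
  rcases h.2 B hB with h1 | ⟨C, hC, hBC, -⟩
  · exact h1
  · exact absurd hbY (Y.notMem_zero_of_mem hC (hBC hb))

/-- Adjoining an edge to `X` amounts to a single merge. -/
theorem exists_merge_of_notMem_edges (X : GPrepartition n G) (e : Fin n ⊕ Fin n × Fin n × G)
    (he : e ∉ X.edges) : ∃ Z : GPrepartition n G, (X.MergeZero Z ∨ X.MergeNonzero Z) ∧
      e ∈ Z.edges ∧ ∀ Y : GPrepartition n G, X.Refines Y → e ∈ Y.edges → Z.Refines Y := by
  have key : ∀ B (hB : B ∈ X.part.parts), e ∈ (X.mergeZero B hB).edges →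
      (∀ Y : GPrepartition n G, X.Refines Y → e ∈ Y.edges → ∃ b ∈ B, b ∈ Y.zero) →
      ∃ Z : GPrepartition n G, (X.MergeZero Z ∨ X.MergeNonzero Z) ∧
      e ∈ Z.edges ∧ ∀ Y : GPrepartition n G, X.Refines Y → e ∈ Y.edges → Z.Refines Y := by
    intro B hB h h'
    refine ⟨_, Or.inl (X.mergeZero_mergeZero B hB), h, fun Y hY heY => ?_⟩
    obtain ⟨b, hb, hbY⟩ := h' Y hY heY
    exact mergeZero_refines hY hB (subset_zero_of_refines hY hB hb hbY)
  rcases e with a | ⟨a, b, g⟩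
  · obtain ⟨B, hB, haB⟩ := X.exists_mem_parts he
    exact key B hB (Finset.mem_union_right _ haB) fun Y _ heY => ⟨a, haB, heY⟩
  · rw [inr_mem_edges, not_or, not_and] at he
    obtain ⟨h1, h2⟩ := he
    by_cases ha : a ∈ X.zero
    · obtain ⟨B, hB, hbB⟩ := X.exists_mem_parts (h1 ha)
      refine key B hB (Or.inl ⟨Finset.mem_union_left _ ha, Finset.mem_union_right _ hbB⟩) ?_
      intro Y hY heY
      rcases (inr_mem_edges ..).1 heY with h | ⟨C, hC, haC, -⟩
      · exact ⟨b, hbB, h.2⟩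
      · exact absurd (hY.1 ha) (Y.notMem_zero_of_mem hC haC)
    · obtain ⟨B, hB, haB⟩ := X.exists_mem_parts ha
      by_cases hb : b ∈ X.zero
      · refine key B hB (Or.inl ⟨Finset.mem_union_right _ haB, Finset.mem_union_left _ hb⟩) ?_
        intro Y hY heY
        rcases (inr_mem_edges ..).1 heY with h | ⟨C, hC, -, hbC, -⟩
        · exact ⟨a, haB, h.1⟩
        · exact absurd (hY.1 hb) (Y.notMem_zero_of_mem hC hbC)
      -- If `b` lies in `B`, the gain `g` contradicts the gain of `X`, and `Y` can contain both only
      -- by absorbing `B` into its zero block.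
      · by_cases hbB : b ∈ B
        · refine key B hB (Or.inl ⟨Finset.mem_union_right _ haB, Finset.mem_union_right _ hbB⟩) ?_
          intro Y hY heY
          refine ⟨a, haB, ?_⟩
          rcases (inr_mem_edges ..).1 heY with h | ⟨C, hC, haC, hbC, hg⟩
          · exact h.1
          · exfalso
            refine h2 ⟨B, hB, haB, hbB, ?_⟩
            rcases hY.2 B hB with h | ⟨D, hD, hBD, g', hg'⟩
            · exact absurd (h haB) (Y.notMem_zero_of_mem hC haC)
            · rw [← hg, hg' a haB, hg' b hbB, add_sub_add_right_eq_sub]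
        · obtain ⟨C, hC, hbC⟩ := X.exists_mem_parts hb
          have hBC : B ≠ C := fun h => hbB (h ▸ hbC)
          have haC : a ∉ C := Finset.disjoint_left.1 (X.disjoint_parts hB hC hBC) haB
          -- The translation of `C` is the solution `h` of `X.label a - (X.label b + h) = g`.
          have hgain : X.label a - (X.label b + (-X.label b + -g + X.label a)) = g := by
            simp [sub_eq_add_neg, add_assoc]
          refine ⟨_, Or.inr (X.mergeNonzero_mergeNonzero B C hB hC hBC
            (-X.label b + -g + X.label a)), ?_, ?_⟩
          · refine Or.inr ⟨B ∪ C, Finset.mem_insert_self _ _, Finset.mem_union_left _ haB,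
              Finset.mem_union_right _ hbC, ?_⟩
            change (if a ∈ C then _ else _) - (if b ∈ C then _ else _) = g
            rw [if_neg haC, if_pos hbC, hgain]
          · intro Y hY heY
            refine mergeNonzero_refines hY hB hC hBC ?_
            rw [inr_mem_edges] at heY
            refine heY.imp (fun h => Finset.union_subset (subset_zero_of_refines hY hB haB h.1)
              (subset_zero_of_refines hY hC hbC h.2)) ?_
            rintro ⟨D, hD, haD, hbD, hg⟩
            exact ⟨D, hD, a, haB, haD, b, hbC, hbD, by rw [hg, hgain]⟩

end GPrepartition

/-! ### The order of the Dowling lattice: edges, covers, joins -/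

namespace GPartition

variable {n : ℕ} {G : Type*} [AddGroup G]

@[simp] theorem parts_mk (X : GPrepartition n G) : (mk X).parts = X.part.parts := rfl

theorem exists_mk (x : GPartition n G) : ∃ X, mk X = x := Quotient.exists_rep x

theorem mk_eq_mk_iff {X Y : GPrepartition n G} : mk X = mk Y ↔ X.Refines Y ∧ Y.Refines X :=
  Quotient.eq.trans GPrepartition.equiv_iff_refines

theorem Merge.refines {X Y : GPrepartition n G} (h : Merge (mk X) (mk Y)) : X.Refines Y := by
  obtain ⟨X', Y', hX, hY, h⟩ := h
  refine ((mk_eq_mk_iff.1 hX).2.trans ?_).trans (mk_eq_mk_iff.1 hY).1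
  exact h.elim GPrepartition.MergeZero.refines GPrepartition.MergeNonzero.refines

theorem Merge.le {x y : GPartition n G} (h : Merge x y) : x ≤ y := Relation.ReflTransGen.single h

theorem merge_mk {X Y : GPrepartition n G} (h : X.MergeZero Y ∨ X.MergeNonzero Y) :
    Merge (mk X) (mk Y) := ⟨X, Y, rfl, rfl, h⟩

/-- For the converse, an edge of `Y` missing from `X` is adjoined by a merge that still refines `Y`;
the number of blocks drops, so the process ends. -/
theorem mk_le_mk_iff {X Y : GPrepartition n G} : mk X ≤ mk Y ↔ X.Refines Y := by
  constructor
  · intro h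
    have key : ∀ z : GPartition n G, mk X ≤ z → ∀ Z, mk Z = z → X.Refines Z := by
      intro z hz
      induction hz with
      | refl => exact fun Z hZ => (mk_eq_mk_iff.1 hZ).2
      | @tail w z _ h ih =>
        intro Z hZ
        obtain ⟨W, rfl⟩ := exists_mk w
        exact (ih W rfl).trans (Merge.refines (hZ ▸ h))
    exact key _ h Y rfl
  · intro h
    induction hc : X.part.parts.card using Nat.strong_induction_on generalizing X with
    | _ c ih =>
      by_cases hYX : Y.Refines X
      · exact (mk_eq_mk_iff.2 ⟨h, hYX⟩).le
      · rw [GPrepartition.refines_iff_edges_subset, Set.not_subset] at hYX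
        obtain ⟨e, heY, heX⟩ := hYX
        obtain ⟨Z, hZ, -, hZ'⟩ := X.exists_merge_of_notMem_edges e heX
        refine (merge_mk hZ).le.trans (ih _ ?_ (hZ' Y h heY) rfl)
        have := (merge_mk hZ).card_lt
        rwa [parts_mk, parts_mk, hc] at this

/-- Elements of the zero block and gains of a `G`-partition. -/
def edges (x : GPartition n G) : Set (Fin n ⊕ Fin n × Fin n × G) :=
  Quotient.lift GPrepartition.edges (fun _ _ h => by
    rw [GPrepartition.equiv_iff_refines, GPrepartition.refines_iff_edges_subset,
      GPrepartition.refines_iff_edges_subset] at h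
    exact h.1.antisymm h.2) x

theorem le_iff_edges_subset {x y : GPartition n G} : x ≤ y ↔ x.edges ⊆ y.edges := by
  obtain ⟨X, rfl⟩ := exists_mk x
  obtain ⟨Y, rfl⟩ := exists_mk y
  exact mk_le_mk_iff.trans GPrepartition.refines_iff_edges_subset

theorem exists_merge_of_notMem_edges {x : GPartition n G} {e : Fin n ⊕ Fin n × Fin n × G}
    (he : e ∉ x.edges) :
    ∃ z, Merge x z ∧ e ∈ z.edges ∧ ∀ y, x ≤ y → e ∈ y.edges → z ≤ y := by
  obtain ⟨X, rfl⟩ := exists_mk x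
  obtain ⟨Z, hZ, heZ, h⟩ := X.exists_merge_of_notMem_edges e he
  refine ⟨mk Z, merge_mk hZ, heZ, fun y hy hey => ?_⟩
  obtain ⟨Y, rfl⟩ := exists_mk y
  exact mk_le_mk_iff.2 (h Y (mk_le_mk_iff.1 hy) hey)

theorem Merge.card_eq {x y : GPartition n G} (h : Merge x y) :
    y.parts.card + 1 = x.parts.card := by
  obtain ⟨X, Y, rfl, rfl, ⟨B, hB, -, h, -⟩ | ⟨B, hB, C, hC, hne, g, -, h, -⟩⟩ := h
  · rw [parts_mk, parts_mk, h, Finset.card_erase_add_one hB]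
  · rw [parts_mk, parts_mk, h]
    have hC' : C ∈ X.part.parts.erase B := Finset.mem_erase.2 ⟨hne.symm, hC⟩
    rw [Finset.card_insert_of_notMem, Finset.card_erase_add_one hC', Finset.card_erase_add_one hB]
    intro hBC
    simp only [Finset.mem_erase] at hBC
    obtain ⟨c, hc⟩ := X.part.nonempty_of_mem_parts hC
    exact hBC.1 (X.part.eq_of_mem_parts hBC.2.2 hC (Finset.mem_union_right _ hc) hc)

theorem Merge.lt {x y : GPartition n G} (h : Merge x y) : x < y :=
  h.le.lt_of_ne fun e => absurd h.card_lt (by rw [e]; exact lt_irrefl _)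

theorem card_lt_of_lt {x y : GPartition n G} (h : x < y) : y.parts.card < x.parts.card :=
  (eq_or_card_lt h.le).resolve_left h.ne

theorem exists_merge_of_lt {x y : GPartition n G} (h : x < y) : ∃ z, Merge x z ∧ z ≤ y := by
  rcases Relation.ReflTransGen.cases_head h.le with h' | ⟨z, hz, hzy⟩
  · exact absurd h' h.ne
  · exact ⟨z, hz, hzy⟩

/-- Semimodularity. An edge `e` of `b` outside `a` generates `b` over `x`, by counting blocks. The
merge `z` of `a` along `e` therefore lies above `b`. -/
theorem exists_merge_of_merge_of_merge {x a b y : GPartition n G} (ha : Merge x a)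
    (hb : Merge x b) (hab : a ≠ b) (hay : a ≤ y) (hby : b ≤ y) :
    ∃ z, Merge a z ∧ b < z ∧ z ≤ y := by
  have hcard : a.parts.card = b.parts.card := by
    have := ha.card_eq
    have := hb.card_eq
    omega
  have hba : ¬ b ≤ a := fun h => (eq_or_card_lt h).elim (fun e => hab e.symm)
    (fun e => by omega)
  have hbx : ¬ b.edges ⊆ a.edges := fun h => hba (le_iff_edges_subset.2 h)
  obtain ⟨e, heb, hea⟩ := Set.not_subset.1 hbx
  obtain ⟨w, hw, hew, hw'⟩ := exists_merge_of_notMem_edges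
    (fun h => hea (le_iff_edges_subset.1 ha.le h))
  have hwb : w = b := by
    refine (eq_or_card_lt (hw' b hb.le heb)).resolve_right ?_
    have := hw.card_eq
    have := hb.card_eq
    omega
  obtain ⟨z, hz, hez, hz'⟩ := exists_merge_of_notMem_edges hea
  refine ⟨z, hz, ?_, hz' y hay (le_iff_edges_subset.1 hby heb)⟩
  refine lt_of_le_of_ne (hwb ▸ hw' z (ha.le.trans hz.le) hez) ?_
  rintro rfl
  have := hz.card_eq
  omega

/-- Among the elements above `x` and below every common upper bound, one with fewest blocks must lie
above `y`: otherwise an edge of `y` could still be adjoined. -/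
theorem exists_isLUB (x y : GPartition n G) : ∃ z, IsLUB {x, y} z := by
  classical
  let S : Set (GPartition n G) := {z | x ≤ z ∧ ∀ w, x ≤ w → y ≤ w → z ≤ w}
  have hS : ∃ c, ∃ z ∈ S, z.parts.card = c := ⟨_, x, ⟨le_rfl, fun _ h _ => h⟩, rfl⟩
  obtain ⟨z, hz, hc⟩ := Nat.find_spec hS
  refine ⟨z, ?_, fun w hw => hz.2 w (hw (by simp)) (hw (by simp))⟩
  suffices y ≤ z by
    rintro w (rfl | rfl)
    exacts [hz.1, this]
  rw [le_iff_edges_subset]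
  by_contra h
  obtain ⟨e, hey, hez⟩ := Set.not_subset.1 h
  obtain ⟨w, hw, -, hw'⟩ := exists_merge_of_notMem_edges hez
  refine Nat.find_min hS (hc ▸ hw.card_lt) ⟨w, ⟨hz.1.trans hw.le, fun v hxv hyv => ?_⟩, rfl⟩
  exact hw' v (hz.2 v hxv hyv) (le_iff_edges_subset.1 hyv hey)

instance [Finite G] : Finite (GPartition n G) := by
  have : Finite (GPrepartition n G) := by
    refine Finite.of_injective
      (fun X : GPrepartition n G => (X.zero, X.part.parts, X.label)) ?_
    rintro ⟨Z, P, l⟩ ⟨Z', P', l'⟩ h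
    simp only [Prod.mk.injEq] at h
    obtain ⟨rfl, h, rfl⟩ := h
    rw [Finpartition.ext h]
  exact inferInstanceAs (Finite (Quotient _))

end GPartition

/-! ### Recursive atom orderings, rank functions and lattices -/

section Posets

theorem exists_sorted_list {P : Type*} [Finite P] (s : Set P) (r : P → P → Prop)
    (total : ∀ a b, r a b ∨ r b a) (trans : ∀ a b c, r a b → r b c → r a c) :
    ∃ l : List P, l.Nodup ∧ (∀ a, a ∈ l ↔ a ∈ s) ∧
      ∀ i j : Fin l.length, i < j → r (l.get i) (l.get j) := by
  classical
  have : Std.Total r := ⟨total⟩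
  have : IsTrans P r := ⟨trans⟩
  refine ⟨(Set.toFinite s).toFinset.toList.insertionSort r, ?_, ?_, ?_⟩
  · exact (List.perm_insertionSort r _).nodup_iff.2 (Finset.nodup_toList _)
  · intro a
    rw [(List.perm_insertionSort r _).mem_iff, Finset.mem_toList, Set.Finite.mem_toFinset]
  · exact List.pairwise_iff_get.1 (List.pairwise_insertionSort r _)

variable {P : Type*} [PartialOrder P]

/-- In an interval `[x, ⊤]` that is semimodular, the atoms can be ordered in an arbitrary way. -/
theorem exists_isRecursiveAtomOrdering_of_semimodular [Finite P] [BoundedOrder P] (x : P)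
    (hx : x < ⊤)
    (semimodular : ∀ w, x ≤ w → ∀ a b y, w ⋖ a → w ⋖ b → a ≠ b → a < y → b < y →
      ∃ z, a ⋖ z ∧ b < z ∧ z ≤ y) (Q : P → Prop) :
    ∃ l, IsRecursiveAtomOrdering x l ∧
      ∀ p q : Fin l.length, Q (l.get p) → ¬ Q (l.get q) → p < q := by
  induction x using WellFoundedGT.induction generalizing Q with
  | _ x ih =>
    by_cases hx' : x ⋖ ⊤
    · refine ⟨[⊤], .base x hx', fun p q hp hq => absurd ?_ hq⟩
      have hpq : p = q := Fin.ext (by have := p.2; have := q.2; simp only [List.length_singleton] at *; omega)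
      rwa [← hpq]
    -- This total preorder puts the atoms satisfying `Q` first, which is what condition (i) asks one
    -- level below.
    · obtain ⟨l, nodup, mem, sorted⟩ := exists_sorted_list {a | x ⋖ a} (fun a b => Q b → Q a)
        (fun a b => by tauto) (fun a b c => by tauto)
      have hl : ∀ j, x ⋖ l.get j := fun j => (mem _).1 (l.get_mem j)
      have hrec : ∀ j, ∃ L, IsRecursiveAtomOrdering (l.get j) L ∧ ∀ p q : Fin L.length,
          (∃ i < j, l.get i ≤ L.get p) → (¬ ∃ i < j, l.get i ≤ L.get q) → p < q := by
        intro j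
        refine ih _ (hl j).lt ?_ (fun w hw => semimodular w ((hl j).le.trans hw))
          (fun q => ∃ i < j, l.get i ≤ q)
        exact lt_top_iff_ne_top.2 fun h => hx' (h ▸ hl j)
      choose L hL hL' using hrec
      refine ⟨l, .step x l hx hx' nodup mem L hL hL' ?_, ?_⟩
      · intro i j hij y hi hj
        obtain ⟨z, hz, hz', hzy⟩ := semimodular x le_rfl _ _ y (hl j) (hl i)
          (fun h => hij.ne' (nodup.injective_get h)) hj hi
        exact ⟨i, hij, z, hz, hz', hzy⟩
      · intro p q hp hq
        by_contra h
        rcases (not_lt.1 h).lt_or_eq with h | rfl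
        · exact hq (sorted q p h hp)
        · exact hq hp

/-- A criterion for recursive atom orderings by means of a function on the atoms that has at most
one local maximum below every element. -/
theorem exists_isRecursiveAtomOrdering_of_isLocalMax_unique [Finite P] [BoundedOrder P]
    {α : Type*} [LinearOrder α] (F : P → α) (hP : (⊥ : P) < ⊤)
    (semimodular : ∀ w : P, w ≠ ⊥ → ∀ a b y, w ⋖ a → w ⋖ b → a ≠ b → a < y → b < y →
      ∃ z, a ⋖ z ∧ b < z ∧ z ≤ y)
    (unique : ∀ a b y : P, ⊥ ⋖ a → ⊥ ⋖ b → a < y → b < y →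
      (∀ z, a ⋖ z → z ≤ y → ∀ c, ⊥ ⋖ c → c ≤ z → F c ≤ F a) →
      (∀ z, b ⋖ z → z ≤ y → ∀ c, ⊥ ⋖ c → c ≤ z → F c ≤ F b) → a = b) :
    ∃ l, IsRecursiveAtomOrdering (⊥ : P) l := by
  by_cases hP' : (⊥ : P) ⋖ ⊤
  · exact ⟨[⊤], .base _ hP'⟩
  obtain ⟨l, nodup, mem, sorted⟩ := exists_sorted_list {a : P | ⊥ ⋖ a} (fun a b => F b ≤ F a)
    (fun a b => le_total _ _) (fun a b c h h' => h'.trans h)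
  have hl : ∀ j, ⊥ ⋖ l.get j := fun j => (mem _).1 (l.get_mem j)
  have hrec : ∀ j, ∃ L, IsRecursiveAtomOrdering (l.get j) L ∧ ∀ p q : Fin L.length,
      (∃ i < j, l.get i ≤ L.get p) → (¬ ∃ i < j, l.get i ≤ L.get q) → p < q := by
    intro j
    refine exists_isRecursiveAtomOrdering_of_semimodular _
      (lt_top_iff_ne_top.2 fun h => hP' (h ▸ hl j))
      (fun w hw => semimodular w (ne_bot_of_le_ne_bot (hl j).lt.ne' hw))
      (fun q => ∃ i < j, l.get i ≤ q)
  choose L hL hL' using hrec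
  refine ⟨l, .step _ l hP hP' nodup mem L hL hL' ?_⟩
  intro i j hij y hi hj
  have ne_of_atom : ∀ a c z : P, ⊥ ⋖ a → ⊥ ⋖ c → a < z → c ≠ z := by
    rintro a c z ha hc haz rfl
    exact hc.2 ha.lt haz
  by_cases hloc : ∀ z, l.get j ⋖ z → z ≤ y → ∀ c, ⊥ ⋖ c → c ≤ z → F c ≤ F (l.get j)
  -- An atom with the largest value of `F` below `y` is a local maximum, so by uniqueness it is
  -- `l.get j`. The earlier `l.get i` has at least that value, so it is a local maximum too and
  -- coincides with `l.get j`.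
  · exfalso
    obtain ⟨m, ⟨hm, hmy⟩, hmax⟩ := Set.exists_max_image {a : P | ⊥ ⋖ a ∧ a < y} F
      (Set.toFinite _) ⟨l.get j, hl j, hj⟩
    have hglob : ∀ a : P, ⊥ ⋖ a → F m ≤ F a →
        ∀ z, a ⋖ z → z ≤ y → ∀ c, ⊥ ⋖ c → c ≤ z → F c ≤ F a := by
      intro a ha hma z hz hzy c hc hcz
      exact (hmax c ⟨hc, (hcz.lt_of_ne (ne_of_atom a c z ha hc hz.lt)).trans_le hzy⟩).trans hma
    have h1 := unique _ _ y (hl j) hm hj hmy hloc (hglob m hm le_rfl)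
    have h2 := unique _ _ y (hl j) (hl i) hj hi hloc
      (hglob _ (hl i) (h1 ▸ sorted i j hij))
    exact hij.ne' (nodup.injective_get h2)
  -- Otherwise some atom `c` below a cover `z` of `l.get j` has a larger value of `F`, hence comes
  -- earlier in the list.
  · push Not at hloc
    obtain ⟨z, hz, hzy, c, hc, hcz, hlt⟩ := hloc
    obtain ⟨p, rfl⟩ := List.get_of_mem ((mem c).2 hc)
    refine ⟨p, ?_, z, hz, hcz.lt_of_ne (ne_of_atom _ _ z (hl j) hc hz.lt), hzy⟩
    by_contra h
    rcases (not_lt.1 h).lt_or_eq with h | rfl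
    · exact hlt.not_ge (sorted j p h)
    · exact hlt.false

/-- For the lower bound, an element `w < x` with the largest value of `ρ` satisfies `ρ x ≤ ρ w + 1`
by `dense`. -/
theorem height_eq_of_rank [Finite P] [OrderBot P] (ρ : P → ℕ) (mono : StrictMono ρ)
    (bot : ρ ⊥ = 0) (dense : ∀ x y, x < y → ρ x + 1 < ρ y → ∃ z, x < z ∧ z < y) (x : P) :
    Order.height x = ρ x := by
  refine le_antisymm ?_ ?_
  · have := Order.height_le_height_apply_of_strictMono ρ mono x
    rwa [Order.height_nat] at this
  · induction x using WellFoundedLT.induction with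
    | _ x ih =>
      rcases eq_or_ne x ⊥ with rfl | hx
      · rw [bot]
        exact zero_le
      · obtain ⟨w, hw, hmax⟩ := Set.exists_max_image {w : P | w < x} ρ (Set.toFinite _)
          ⟨⊥, bot_lt_iff_ne_bot.2 hx⟩
        have h : ρ x ≤ ρ w + 1 := by
          by_contra! h
          obtain ⟨z, hz, hzx⟩ := dense w x hw h
          exact (mono hz).not_ge (hmax z hzx)
        calc (ρ x : ℕ∞) ≤ ρ w + 1 := by exact_mod_cast h
          _ ≤ Order.height w + 1 := by gcongr; exact ih w hw
          _ ≤ Order.height x := Order.height_add_one_le hw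

/-- `ρ` maps a maximal chain bijectively onto `{0, …, ρ ⊤}`: around a missing value two neighbours
of the chain differ by at least two in rank, and `dense` would enlarge the chain. -/
theorem isPure_of_rank [Finite P] [BoundedOrder P] (ρ : P → ℕ) (mono : StrictMono ρ)
    (bot : ρ ⊥ = 0) (dense : ∀ x y, x < y → ρ x + 1 < ρ y → ∃ z, x < z ∧ z < y) :
    IsPure P := by
  suffices h : ∀ s : Set P, IsMaxChain (· ≤ ·) s → s.encard = (Set.Iic (ρ ⊤)).encard from
    fun s t hs ht => (h s hs).trans (h t ht).symm
  intro s hs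
  have hle : ∀ x ∈ s, ∀ y ∈ s, ρ x ≤ ρ y → x ≤ y := by
    intro x hx y hy h
    rcases hs.isChain.total hx hy with h' | h'
    · exact h'
    · rcases h'.lt_or_eq with h' | h'
      · exact absurd (mono h') h.not_gt
      · exact h'.ge
  have hinj : Set.InjOn ρ s := fun x hx y hy h => (hle x hx y hy h.le).antisymm (hle y hy x hx h.ge)
  rw [← hinj.encard_image]
  congr 1
  apply Set.Subset.antisymm
  · rintro _ ⟨x, -, rfl⟩
    exact mono.monotone le_top
  · intro i hi
    by_contra hi'
    have hne : ∀ x ∈ s, ρ x ≠ i := fun x hx h => hi' ⟨x, hx, h⟩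
    obtain ⟨x, ⟨hx, hxi⟩, hxmax⟩ := Set.exists_max_image {x ∈ s | ρ x < i} ρ (Set.toFinite _)
      ⟨⊥, hs.bot_mem, lt_of_le_of_ne (bot ▸ Nat.zero_le i) (hne ⊥ hs.bot_mem)⟩
    obtain ⟨y, ⟨hy, hyi⟩, hymin⟩ := Set.exists_min_image {y ∈ s | i < ρ y} ρ (Set.toFinite _)
      ⟨⊤, hs.top_mem, lt_of_le_of_ne hi (hne ⊤ hs.top_mem).symm⟩
    have hxy : x < y := (hle x hx y hy (hxi.trans hyi).le).lt_of_ne fun h => by subst h; omega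
    obtain ⟨z, hxz, hzy⟩ := dense x y hxy (by omega)
    have key : ∀ w ∈ s, w < z ∨ z < w := by
      intro w hw
      rcases (hne w hw).lt_or_gt with h | h
      · exact Or.inl ((hle w hw x hx (hxmax w ⟨hw, h⟩)).trans_lt hxz)
      · exact Or.inr (hzy.trans_le (hle y hy w hw (hymin w ⟨hw, h⟩)))
    have hz : z ∈ s := by
      have := hs.2 (hs.isChain.insert fun w hw _ =>
        (key w hw).elim (fun h => Or.inr h.le) (fun h => Or.inl h.le)) (Set.subset_insert z s)
      rw [this]
      exact Set.mem_insert z s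
    exact (key z hz).elim (lt_irrefl z) (lt_irrefl z)

/-- A maximal common lower bound is the greatest one, because its join with any other lower bound is
again a lower bound. -/
theorem isLatticeOrder_of_exists_isLUB [Finite P] [OrderBot P]
    (h : ∀ x y : P, ∃ z, IsLUB {x, y} z) : IsLatticeOrder P := by
  refine fun x y => ⟨h x y, ?_⟩
  obtain ⟨w, -, hw⟩ := (Set.toFinite (lowerBounds {x, y})).exists_le_maximal
    (a := ⊥) (fun _ _ => bot_le)
  refine ⟨w, hw.prop, fun v hv => ?_⟩
  obtain ⟨z, hz⟩ := h v w
  have hz' : z ∈ lowerBounds {x, y} := fun u hu => hz.2 (by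
    rintro t (rfl | rfl)
    exacts [hv hu, hw.prop hu])
  exact (hz.1 (by simp)).trans (hw.le_of_ge hz' (hz.1 (by simp)))

end Posets

/-! ### Balanced blocks -/

section Balanced

variable {n r k : ℕ}

/-- The number of elements of `B` of a given colour modulo `k` does not depend on the colour. -/
def IsBalanced (k : ℕ) (l : Fin n → ZMod r) (B : Finset (Fin n)) : Prop :=
  ∀ i j : ZMod k, (B.filter fun a => (l a).cast = i).card = (B.filter fun a => (l a).cast = j).card

/-- Because `k ∣ r`, reduction modulo `k` is additive, so a translation only permutes the colours.
-/
theorem IsBalanced.of_translate (hkr : k ∣ r) {l l' : Fin n → ZMod r} {B : Finset (Fin n)}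
    (h : IsBalanced k l B) (g : ZMod r) (hg : ∀ a ∈ B, l' a = l a + g) : IsBalanced k l' B := by
  have key : ∀ i : ZMod k, (B.filter fun a => ((l' a).cast : ZMod k) = i) =
      B.filter fun a => ((l a).cast : ZMod k) = i - g.cast := by
    intro i
    refine Finset.filter_congr fun a ha => ?_
    rw [hg a ha, ZMod.cast_add hkr, eq_sub_iff_add_eq]
  intro i j
  rw [key, key]
  exact h _ _

theorem IsBalanced.congr {l l' : Fin n → ZMod r} {B : Finset (Fin n)}
    (h : IsBalanced k l B) (hl : ∀ a ∈ B, ((l' a).cast : ZMod k) = (l a).cast) :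
    IsBalanced k l' B := by
  have key : ∀ i : ZMod k, (B.filter fun a => ((l' a).cast : ZMod k) = i) =
      B.filter fun a => ((l a).cast : ZMod k) = i :=
    fun i => Finset.filter_congr fun a ha => by rw [hl a ha]
  intro i j
  rw [key, key]
  exact h _ _

theorem IsBalanced.union {l : Fin n → ZMod r} {B C : Finset (Fin n)} (hBC : Disjoint B C)
    (hB : IsBalanced k l B) (hC : IsBalanced k l C) : IsBalanced k l (B ∪ C) := by
  intro i j
  rw [Finset.filter_union, Finset.filter_union,
    Finset.card_union_of_disjoint (Finset.disjoint_filter_filter hBC),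
    Finset.card_union_of_disjoint (Finset.disjoint_filter_filter hBC), hB i j, hC i j]

theorem IsBalanced.sdiff {l : Fin n → ZMod r} {B D : Finset (Fin n)} (hDB : D ⊆ B)
    (hB : IsBalanced k l B) (hD : IsBalanced k l D) : IsBalanced k l (B \ D) := by
  have key : ∀ i : ZMod k, ((B \ D).filter fun a => ((l a).cast : ZMod k) = i).card +
      (D.filter fun a => ((l a).cast : ZMod k) = i).card =
      (B.filter fun a => ((l a).cast : ZMod k) = i).card := by
    intro i
    rw [← Finset.card_union_of_disjoint (Finset.disjoint_filter_filter Finset.sdiff_disjoint),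
      ← Finset.filter_union, Finset.sdiff_union_of_subset hDB]
  intro i j
  have h1 := key i
  have h2 := key j
  have h3 := hB i j
  have h4 := hD i j
  omega

theorem IsBalanced.card_eq [NeZero k] {l : Fin n → ZMod r} {B : Finset (Fin n)}
    (h : IsBalanced k l B) (i : ZMod k) :
    B.card = k * (B.filter fun a => ((l a).cast : ZMod k) = i).card := by
  rw [Finset.card_eq_sum_card_fiberwise (f := fun a => ((l a).cast : ZMod k)) (t := Finset.univ)
    (fun _ _ => Finset.mem_coe.2 (Finset.mem_univ _)), Finset.sum_congr rfl fun j _ => h j i,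
    Finset.sum_const, Finset.card_univ, ZMod.card, smul_eq_mul]

/-- Identify `C` with `Fin e × ZMod k` and colour by the second coordinate. -/
theorem exists_isBalanced [NeZero k] (hkr : k ∣ r) {C : Finset (Fin n)} (h : k ∣ C.card) :
    ∃ l : Fin n → ZMod r, IsBalanced k l C := by
  obtain ⟨e, he⟩ := h
  have hcard : Fintype.card C = Fintype.card (Fin e × ZMod k) := by
    rw [Fintype.card_coe, Fintype.card_prod, Fintype.card_fin, ZMod.card, he, mul_comm]
  let φ := Fintype.equivOfCardEq hcard
  let l : Fin n → ZMod r := fun a => if h : a ∈ C then ((φ ⟨a, h⟩).2.val : ZMod r) else 0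
  refine ⟨l, ?_⟩
  have hl : ∀ a : C, ((l a).cast : ZMod k) = (φ a).2 := by
    intro a
    have : l a = ((φ a).2.val : ZMod r) := dif_pos a.2
    rw [this, ZMod.cast_natCast hkr, ZMod.natCast_zmod_val]
  have key : ∀ i : ZMod k, (C.filter fun a => ((l a).cast : ZMod k) = i).card = e := by
    intro i
    have h1 : (C.filter fun a => ((l a).cast : ZMod k) = i) =
        ((Finset.univ : Finset (Fin e)) ×ˢ {i}).map
          (φ.symm.toEmbedding.trans (Function.Embedding.subtype _)) := by
      ext a
      simp only [Finset.mem_filter, Finset.mem_map, Finset.mem_product, Finset.mem_univ,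
        true_and, Finset.mem_singleton, Function.Embedding.trans_apply, Equiv.coe_toEmbedding,
        Function.Embedding.subtype_apply]
      constructor
      · rintro ⟨ha, hi⟩
        refine ⟨φ ⟨a, ha⟩, ?_, by simp⟩
        rw [← hl ⟨a, ha⟩, hi]
      · rintro ⟨p, hp, rfl⟩
        refine ⟨(φ.symm p).2, ?_⟩
        rw [hl, φ.apply_symm_apply, hp]
    rw [h1, Finset.card_map, Finset.card_product, Finset.card_univ, Fintype.card_fin,
      Finset.card_singleton, mul_one]
  exact fun i j => (key i).trans (key j).symm

/-- Take `e` elements from each colour class. -/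
theorem IsBalanced.exists_subset [NeZero k] {l : Fin n → ZMod r} {B : Finset (Fin n)}
    (h : IsBalanced k l B) {e : ℕ} (he : k * e ≤ B.card) :
    ∃ D ⊆ B, D.card = k * e ∧ IsBalanced k l D := by
  have h1 : ∀ i : ZMod k, ∃ D ⊆ B.filter fun a => ((l a).cast : ZMod k) = i, D.card = e := by
    intro i
    refine Finset.exists_subset_card_eq ?_
    rw [h.card_eq i] at he
    exact le_of_mul_le_mul_left he (NeZero.pos k)
  choose D hD hDe using h1
  have key : ∀ i : ZMod k,
      ((Finset.univ.biUnion D).filter fun a => ((l a).cast : ZMod k) = i) = D i := by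
    intro i
    ext a
    simp only [Finset.mem_filter, Finset.mem_biUnion, Finset.mem_univ, true_and]
    constructor
    · rintro ⟨⟨j, hj⟩, rfl⟩
      rwa [(Finset.mem_filter.1 (hD j hj)).2]
    · exact fun ha => ⟨⟨i, ha⟩, (Finset.mem_filter.1 (hD i ha)).2⟩
  have hbal : IsBalanced k l (Finset.univ.biUnion D) := fun i j => by rw [key, key, hDe, hDe]
  refine ⟨_, ?_, ?_, hbal⟩
  · exact Finset.biUnion_subset.2 fun i _ => (hD i).trans (Finset.filter_subset _ _)
  · rw [hbal.card_eq 0, key, hDe]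

end Balanced

/-! ### Good prepartitions: counting and splitting blocks -/

namespace GPrepartition

variable {n r : ℕ}

/-- The zero block is nonempty, and the nonzero blocks are divisible by `d` and balanced. -/
def IsGood (d k : ℕ) (X : GPrepartition n (ZMod r)) : Prop :=
  X.zero.Nonempty ∧ ∀ B ∈ X.part.parts, d ∣ B.card ∧ IsBalanced k X.label B

theorem IsGood.mergeZero {d k : ℕ} {X Y : GPrepartition n (ZMod r)} (h : X.IsGood d k)
    (hXY : X.MergeZero Y) : Y.IsGood d k := by
  obtain ⟨B, -, h0, hp, hl⟩ := hXY
  refine ⟨h.1.mono (h0 ▸ Finset.subset_union_left), fun C hC => ?_⟩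
  have hCX : C ∈ X.part.parts := Finset.mem_of_mem_erase (hp ▸ hC)
  exact ⟨(h.2 C hCX).1, (h.2 C hCX).2.congr
    fun a ha => by rw [hl a (Y.notMem_zero_of_mem hC ha)]⟩

theorem IsGood.mergeNonzero {d k : ℕ} (hkr : k ∣ r) {X Y : GPrepartition n (ZMod r)}
    (h : X.IsGood d k) (hXY : X.MergeNonzero Y) : Y.IsGood d k := by
  obtain ⟨B, hB, C, hC, hBC, g, h0, hp, hl⟩ := hXY
  have hdis := X.disjoint_parts hB hC hBC
  refine ⟨h0 ▸ h.1, fun D hD => ?_⟩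
  have hDY := hD
  rw [hp] at hD
  have hother : ∀ E ∈ X.part.parts, E ≠ C → IsBalanced k Y.label E := by
    intro E hE hEC
    refine (h.2 E hE).2.congr fun a ha => ?_
    rw [hl a (h0 ▸ X.notMem_zero_of_mem hE ha),
      if_neg fun h => hEC (X.part.eq_of_mem_parts hE hC ha h)]
  rcases Finset.mem_insert.1 hD with rfl | hD
  · refine ⟨?_, (hother B hB hBC).union hdis ((h.2 C hC).2.of_translate hkr g fun a ha => ?_)⟩
    · rw [Finset.card_union_of_disjoint hdis]
      exact dvd_add (h.2 B hB).1 (h.2 C hC).1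
    · rw [hl a (h0 ▸ X.notMem_zero_of_mem hC ha), if_pos ha]
  · simp only [Finset.mem_erase] at hD
    exact ⟨(h.2 D hD.2.2).1, hother D hD.2.2 hD.1⟩

theorem card_zero_add_sum_card (X : GPrepartition n (ZMod r)) :
    X.zero.card + ∑ B ∈ X.part.parts, B.card = n := by
  rw [X.part.sum_card_parts, Finset.card_add_card_compl, Fintype.card_fin]

theorem IsGood.dvd_card_zero {d k : ℕ} (hnd : d ∣ n) {X : GPrepartition n (ZMod r)}
    (h : X.IsGood d k) : d ∣ X.zero.card := by
  rw [← X.card_zero_add_sum_card] at hnd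
  exact (Nat.dvd_add_left (Finset.dvd_sum fun B hB => (h.2 B hB).1)).1 hnd

theorem IsGood.le_card_zero {d k : ℕ} (hnd : d ∣ n) {X : GPrepartition n (ZMod r)}
    (h : X.IsGood d k) : d ≤ X.zero.card :=
  Nat.le_of_dvd h.1.card_pos (h.dvd_card_zero hnd)

theorem IsGood.le_card {d k : ℕ} {X : GPrepartition n (ZMod r)}
    (h : X.IsGood d k) {B : Finset (Fin n)} (hB : B ∈ X.part.parts) : d ≤ B.card :=
  Nat.le_of_dvd (X.part.nonempty_of_mem_parts hB).card_pos (h.2 B hB).1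

theorem IsGood.card_parts_lt {d k : ℕ} (hd : 0 < d) (hnd : d ∣ n) {X : GPrepartition n (ZMod r)}
    (h : X.IsGood d k) : X.part.parts.card + 1 ≤ n / d := by
  rw [Nat.le_div_iff_mul_le hd]
  refine le_of_le_of_eq ?_ X.card_zero_add_sum_card
  rw [add_mul, one_mul, add_comm]
  exact add_le_add (h.le_card_zero hnd) (Finset.card_nsmul_le_sum _ _ _ fun B hB => h.le_card hB)

theorem IsGood.card_eq_of_card_parts {d k : ℕ} (hnd : d ∣ n) {X : GPrepartition n (ZMod r)}
    (h : X.IsGood d k) (hX : X.part.parts.card + 1 = n / d) :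
    X.zero.card = d ∧ ∀ B ∈ X.part.parts, B.card = d := by
  have h1 : (X.part.parts.card + 1) * d = n := by rw [hX, Nat.div_mul_cancel hnd]
  have h2 := X.card_zero_add_sum_card
  have h3 : ∑ B ∈ X.part.parts, d ≤ ∑ B ∈ X.part.parts, B.card :=
    Finset.sum_le_sum fun B hB => h.le_card hB
  have h4 := h.le_card_zero hnd
  have h5 : ∑ B ∈ X.part.parts, d = X.part.parts.card * d := by
    rw [Finset.sum_const, smul_eq_mul]
  rw [add_mul] at h1
  refine ⟨by omega, fun B hB => ?_⟩
  have h6 : ∑ B ∈ X.part.parts, d = ∑ B ∈ X.part.parts, B.card := by omega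
  exact ((Finset.sum_eq_sum_iff_of_le fun B hB => h.le_card hB).1 h6 B hB).symm

theorem card_parts_of_card_eq {d : ℕ} (hd : 0 < d) {X : GPrepartition n (ZMod r)}
    (h0 : X.zero.card = d) (h : ∀ B ∈ X.part.parts, B.card = d) :
    X.part.parts.card + 1 = n / d := by
  have h2 := X.card_zero_add_sum_card
  rw [Finset.sum_congr rfl h, Finset.sum_const, smul_eq_mul, h0, add_comm, ← Nat.succ_mul] at h2
  exact (Nat.div_eq_of_eq_mul_left hd h2.symm).symm

/-- Splitting the nonzero block `B` along a subset `D`. -/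
theorem exists_mergeNonzero_of_subset {G : Type*} [AddGroup G] (X : GPrepartition n G)
    {B D : Finset (Fin n)} (hB : B ∈ X.part.parts) (hD : D.Nonempty) (hDB : D ⊂ B) :
    ∃ W : GPrepartition n G, W.MergeNonzero X ∧ W.zero = X.zero ∧ W.label = X.label ∧
      W.part.parts = insert D (insert (B \ D) (X.part.parts.erase B)) := by
  have hBD : (B \ D).Nonempty := Finset.sdiff_nonempty.2 hDB.2
  have hdis : ∀ E ∈ X.part.parts.erase B, ∀ a ∈ E, a ∉ B := fun E hE a ha haB =>
    Finset.ne_of_mem_erase hE (X.part.eq_of_mem_parts (Finset.mem_of_mem_erase hE) hB ha haB)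
  have hD' : D ∉ X.part.parts.erase B := fun h =>
    hdis D h _ hD.choose_spec (hDB.1 hD.choose_spec)
  have hBD' : B \ D ∉ X.part.parts.erase B := fun h =>
    hdis _ h _ hBD.choose_spec (Finset.mem_sdiff.1 hBD.choose_spec).1
  have hne : D ≠ B \ D := fun h => by
    have h1 := hD.choose_spec
    have h2 : hD.choose ∈ B \ D := h ▸ h1
    exact (Finset.mem_sdiff.1 h2).2 h1
  refine ⟨ofParts X.zero (insert D (insert (B \ D) (X.part.parts.erase B))) X.label ?_ ?_ ?_,
    ⟨D, Finset.mem_insert_self _ _, B \ D, Finset.mem_insert_of_mem (Finset.mem_insert_self _ _),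
      hne, 0, rfl, ?_, ?_⟩, rfl, rfl, rfl⟩
  · intro a
    simp only [Finset.forall_mem_insert]
    constructor
    · intro h
      exact ⟨fun h' => X.notMem_zero_of_mem hB (hDB.1 h') h,
        fun h' => X.notMem_zero_of_mem hB (Finset.mem_sdiff.1 h').1 h,
        fun E hE h' => X.notMem_zero_of_mem (Finset.mem_of_mem_erase hE) h' h⟩
    · rintro ⟨h1, h2, h3⟩
      by_contra h
      obtain ⟨E, hE, haE⟩ := X.exists_mem_parts h
      by_cases hEB : E = B
      · subst hEB
        exact h2 (Finset.mem_sdiff.2 ⟨haE, h1⟩)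
      · exact h3 E (Finset.mem_erase.2 ⟨hEB, hE⟩) haE
  · simp only [Finset.forall_mem_insert]
    refine ⟨⟨fun _ _ _ => trivial, fun a h h' => absurd h (Finset.mem_sdiff.1 h').2,
      fun E hE a h h' => absurd (hDB.1 h) (hdis E hE a h')⟩,
      ⟨fun a h h' => absurd h' (Finset.mem_sdiff.1 h).2, fun _ _ _ => trivial,
      fun E hE a h h' => absurd (Finset.mem_sdiff.1 h).1 (hdis E hE a h')⟩,
      fun E hE => ⟨fun a h h' => absurd (hDB.1 h') (hdis E hE a h),
      fun a h h' => absurd (Finset.mem_sdiff.1 h').1 (hdis E hE a h),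
      fun F hF a h h' => X.part.eq_of_mem_parts (Finset.mem_of_mem_erase hE)
        (Finset.mem_of_mem_erase hF) h h'⟩⟩
  · simp only [Finset.mem_insert, not_or]
    exact ⟨hD.ne_empty.symm, hBD.ne_empty.symm,
      fun h => X.part.empty_notMem_parts (Finset.mem_of_mem_erase h)⟩
  · change _ = insert _ (((insert D (insert (B \ D) (X.part.parts.erase B))).erase D).erase (B \ D))
    rw [Finset.erase_insert (by simp [hne, hD']), Finset.erase_insert hBD',
      Finset.union_sdiff_of_subset hDB.1, Finset.insert_erase hB]
  · intro a _
    change _ = if _ then X.label a + 0 else X.label a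
    rw [add_zero, ite_self]

/-- Splitting a subset `C` with labelling `l` off the zero block. -/
theorem exists_mergeZero_of_subset {G : Type*} (X : GPrepartition n G)
    {C : Finset (Fin n)} (hC : C.Nonempty) (hCX : C ⊆ X.zero) (l : Fin n → G)
    (hl : ∀ a ∉ X.zero, l a = X.label a) :
    ∃ W : GPrepartition n G, W.MergeZero X ∧ W.zero = X.zero \ C ∧ W.label = l ∧
      W.part.parts = insert C X.part.parts := by
  have hdis : ∀ E ∈ X.part.parts, ∀ a ∈ E, a ∉ C := fun E hE a ha haC =>
    X.notMem_zero_of_mem hE ha (hCX haC)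
  have hC' : C ∉ X.part.parts := fun h => hdis C h _ hC.choose_spec hC.choose_spec
  refine ⟨ofParts (X.zero \ C) (insert C X.part.parts) l ?_ ?_ ?_,
    ⟨C, Finset.mem_insert_self _ _, (Finset.sdiff_union_of_subset hCX).symm,
      (Finset.erase_insert hC').symm, fun a ha => (hl a ha).symm⟩, rfl, rfl, rfl⟩
  · intro a
    simp only [Finset.forall_mem_insert, Finset.mem_sdiff]
    constructor
    · exact fun h => ⟨h.2, fun E hE h' => X.notMem_zero_of_mem hE h' h.1⟩
    · rintro ⟨h1, h2⟩
      refine ⟨?_, h1⟩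
      by_contra h
      obtain ⟨E, hE, haE⟩ := X.exists_mem_parts h
      exact h2 E hE haE
  · simp only [Finset.forall_mem_insert]
    exact ⟨⟨fun _ _ _ => trivial, fun E hE a h h' => absurd h (hdis E hE a h')⟩,
      fun E hE => ⟨fun a h h' => absurd h' (hdis E hE a h),
      fun F hF a h h' => X.part.eq_of_mem_parts hE hF h h'⟩⟩
  · simp only [Finset.mem_insert, not_or]
    exact ⟨hC.ne_empty.symm, X.part.empty_notMem_parts⟩

/-- Off the minimal rank some block is larger than `d`. From a nonzero block one splits a balanced
subset of size `d`. From the zero block one splits any `d` elements and gives them a balanced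
labelling, which the zero block does not remember. -/
theorem IsGood.exists_merge {d k : ℕ} (hd : 0 < d) (hkr : k ∣ r) (hkd : k ∣ d) (hnd : d ∣ n)
    {X : GPrepartition n (ZMod r)} (h : X.IsGood d k) (hX : X.part.parts.card + 1 ≠ n / d) :
    ∃ W : GPrepartition n (ZMod r), W.IsGood d k ∧ (W.MergeZero X ∨ W.MergeNonzero X) := by
  have hk : NeZero k := ⟨fun e => by subst e; rw [zero_dvd_iff] at hkd; omega⟩
  by_cases h0 : X.zero.card = d
  · have hB : ∃ B ∈ X.part.parts, B.card ≠ d := by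
      by_contra! hall
      exact hX (card_parts_of_card_eq hd h0 hall)
    obtain ⟨B, hB, hBd⟩ := hB
    obtain ⟨e, rfl⟩ := hkd
    obtain ⟨D, hDB, hDcard, hD⟩ := (h.2 B hB).2.exists_subset (h.le_card hB)
    have hDne : D.Nonempty := Finset.card_pos.1 (hDcard ▸ hd)
    obtain ⟨W, hW, hW0, hWl, hWp⟩ := X.exists_mergeNonzero_of_subset hB hDne
      (hDB.ssubset_of_ne fun e => hBd (e ▸ hDcard))
    refine ⟨W, ⟨hW0 ▸ h.1, ?_⟩, Or.inr hW⟩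
    rw [hWp, hWl]
    simp only [Finset.forall_mem_insert]
    refine ⟨⟨hDcard.symm.dvd, hD⟩, ⟨?_, (h.2 B hB).2.sdiff hDB hD⟩,
      fun E hE => h.2 E (Finset.mem_of_mem_erase hE)⟩
    rw [Finset.card_sdiff_of_subset hDB, hDcard]
    exact Nat.dvd_sub (h.2 B hB).1 dvd_rfl
  · have hlt : d < X.zero.card := (h.le_card_zero hnd).lt_of_ne' h0
    obtain ⟨C, hC, hCd⟩ := Finset.exists_subset_card_eq hlt.le
    have hCne : C.Nonempty := Finset.card_pos.1 (hCd ▸ hd)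
    obtain ⟨l, hl⟩ := exists_isBalanced (r := r) hkr (hCd.symm ▸ hkd : k ∣ C.card)
    obtain ⟨W, hW, hW0, hWl, hWp⟩ := X.exists_mergeZero_of_subset hCne hC
      (fun a => if a ∈ C then l a else X.label a) (fun a ha => if_neg fun h => ha (hC h))
    refine ⟨W, ⟨?_, ?_⟩, Or.inl hW⟩
    · rw [hW0, Finset.sdiff_nonempty]
      exact fun h' => hlt.not_ge (hCd ▸ Finset.card_le_card h')
    · rw [hWp, hWl]
      simp only [Finset.forall_mem_insert]
      refine ⟨⟨hCd.symm.dvd, hl.congr fun a ha => by rw [if_pos ha]⟩, fun E hE =>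
        ⟨(h.2 E hE).1, (h.2 E hE).2.congr fun a ha => ?_⟩⟩
      rw [if_neg fun h' => X.notMem_zero_of_mem hE ha (hC h')]

end GPrepartition

/-! ### Good elements form an upper set -/

namespace GPartition

variable {n r : ℕ}

/-- The zero block is nonempty, and the nonzero blocks are divisible by `d` and balanced. -/
def IsGood (d k : ℕ) (x : GPartition n (ZMod r)) : Prop :=
  ∃ X : GPrepartition n (ZMod r), mk X = x ∧ X.IsGood d k

theorem isGood_mk {d k : ℕ} (hkr : k ∣ r) {X : GPrepartition n (ZMod r)} :
    (mk X).IsGood d k ↔ X.IsGood d k := by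
  refine ⟨?_, fun h => ⟨X, rfl, h⟩⟩
  rintro ⟨Y, hY, h⟩
  rw [mk_eq_mk_iff] at hY
  refine ⟨h.1.mono hY.1.1, fun B hB => ?_⟩
  have hBY := (GPrepartition.parts_subset_of_refines hY.2 hY.1 hB).1
  obtain ⟨-, g, hg⟩ := GPrepartition.parts_subset_of_refines hY.1 hY.2 hBY
  exact ⟨(h.2 B hBY).1, (h.2 B hBY).2.of_translate hkr g hg⟩

/-- This makes the interval above a good element the same in the subposet as in the whole Dowling
lattice. -/
theorem IsGood.of_le {d k : ℕ} (hkr : k ∣ r) {x y : GPartition n (ZMod r)} (h : x.IsGood d k)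
    (hxy : x ≤ y) : y.IsGood d k := by
  induction hxy with
  | refl => exact h
  | tail _ hm ih =>
    obtain ⟨X, Y, rfl, rfl, hXY⟩ := hm
    rw [isGood_mk hkr] at ih ⊢
    exact hXY.elim ih.mergeZero (ih.mergeNonzero hkr)

theorem isGood_iff {d k : ℕ} (hkr : k ∣ r) {x : GPartition n (ZMod r)} :
    x.IsGood d k ↔ x.zero.Nonempty ∧ x.IsDivisible d ∧ x.IsEvenlyColoured k := by
  constructor
  · intro h
    refine ⟨?_, ?_, fun X hX => ?_⟩
    · obtain ⟨X, rfl, h⟩ := h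
      exact h.1
    · obtain ⟨X, rfl, h⟩ := h
      exact fun B hB => (h.2 B hB).1
    · rw [← hX, isGood_mk hkr] at h
      exact fun B hB => (h.2 B hB).2
  · rintro ⟨h0, h1, h2⟩
    obtain ⟨X, rfl⟩ := exists_mk x
    exact ⟨X, rfl, h0, fun B hB => ⟨h1 B hB, h2 X rfl B hB⟩⟩

theorem zero_zeroHat : (zeroHat n (ZMod r)).zero = ∅ := rfl

theorem IsGood.ne_zeroHat {d k : ℕ} {x : GPartition n (ZMod r)} (h : x.IsGood d k) :
    x ≠ zeroHat n (ZMod r) := by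
  rintro rfl
  obtain ⟨X, hX, h⟩ := h
  have : X.zero = ∅ := (congrArg zero hX).trans zero_zeroHat
  exact Finset.not_nonempty_empty (this ▸ h.1)

theorem mem_QnrdkJ_iff {d k : ℕ} (hkr : k ∣ r) {x : GPartition n (ZMod r)} :
    x ∈ QnrdkJ n r d k {0} ↔ x = zeroHat n (ZMod r) ∨ x.IsGood d k := by
  rw [isGood_iff hkr]
  have hzero : x.zero.Nonempty → x ≠ zeroHat n (ZMod r) := by
    rintro h rfl
    exact Finset.not_nonempty_empty h
  simp only [QnrdkJ, Qnrdk, Qnrd, Set.mem_ofPred_eq, Set.mem_singleton_iff, Finset.card_eq_zero,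
    ← ne_eq, ← Finset.nonempty_iff_ne_empty]
  tauto

theorem zeroHat_le (x : GPartition n (ZMod r)) : zeroHat n (ZMod r) ≤ x := by
  obtain ⟨X, rfl⟩ := exists_mk x
  refine mk_le_mk_iff.2 ⟨Finset.empty_subset _, fun B hB => ?_⟩
  obtain ⟨a, -, rfl⟩ := Finpartition.mem_bot_iff.1 hB
  by_cases ha : a ∈ X.zero
  · exact Or.inl (Finset.singleton_subset_iff.2 ha)
  · obtain ⟨C, hC, haC⟩ := X.exists_mem_parts ha
    refine Or.inr ⟨C, hC, Finset.singleton_subset_iff.2 haC, X.label a, fun b hb => ?_⟩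
    rw [Finset.mem_singleton.1 hb, zero_add]

/-- The element `1̂` of `Q_n(r)`: all elements of `[n]` are in the zero block. -/
def oneHat (n r : ℕ) : GPartition n (ZMod r) :=
  mk (GPrepartition.ofParts Finset.univ ∅ (fun _ => 0) (by simp) (by simp) (by simp))

theorem le_oneHat (x : GPartition n (ZMod r)) : x ≤ oneHat n r := by
  obtain ⟨X, rfl⟩ := exists_mk x
  exact mk_le_mk_iff.2 ⟨Finset.subset_univ _, fun B _ => Or.inl (Finset.subset_univ _)⟩

theorem isGood_oneHat {d k : ℕ} (hn : 0 < n) : (oneHat n r).IsGood d k :=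
  ⟨_, rfl, ⟨⟨0, hn⟩, Finset.mem_univ _⟩, fun B hB => absurd hB (Finset.notMem_empty B)⟩

theorem IsGood.exists_merge {d k : ℕ} (hd : 0 < d) (hkr : k ∣ r) (hkd : k ∣ d) (hnd : d ∣ n)
    {x : GPartition n (ZMod r)} (h : x.IsGood d k) (hx : x.parts.card + 1 ≠ n / d) :
    ∃ w : GPartition n (ZMod r), w.IsGood d k ∧ Merge w x := by
  obtain ⟨X, rfl, h⟩ := h
  obtain ⟨W, hW, hWX⟩ := h.exists_merge hd hkr hkd hnd hx
  exact ⟨mk W, ⟨W, rfl, hW⟩, merge_mk hWX⟩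

theorem IsGood.card_parts_lt {d k : ℕ} (hd : 0 < d) (hnd : d ∣ n) {x : GPartition n (ZMod r)}
    (h : x.IsGood d k) : x.parts.card + 1 ≤ n / d := by
  obtain ⟨X, rfl, h⟩ := h
  exact h.card_parts_lt hd hnd

end GPartition

/-! ### Uniqueness of sorted partitions -/

section SortedPartition

variable {α κ : Type*} [LinearOrder α] [DecidableEq κ]

/-- Elements of `C` are smaller than elements of `D` of the same colour. -/
def Precedes (c : α → κ) (C D : Finset α) : Prop :=
  ∀ u ∈ C, ∀ v ∈ D, c u = c v → u < v

/-- A partition `P` of `B` into blocks with `e` elements of each colour, any two of which are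
comparable colour by colour. -/
structure IsSortedPartition (c : α → κ) (e : ℕ) (B : Finset α) (P : Finset (Finset α)) :
    Prop where
  subset : ∀ C ∈ P, C ⊆ B
  exists_mem : ∀ a ∈ B, ∃ C ∈ P, a ∈ C
  disjoint : ∀ C ∈ P, ∀ D ∈ P, C ≠ D → Disjoint C D
  card_eq : ∀ C ∈ P, ∀ j, (C.filter fun a => c a = j).card = e
  total : ∀ C ∈ P, ∀ D ∈ P, C ≠ D → Precedes c C D ∨ Precedes c D C

namespace IsSortedPartition

variable {c : α → κ} {e : ℕ} {B : Finset α} {P P' : Finset (Finset α)}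

open Classical in
-- Among the elements below `a` of its colour, each block preceding `C` contributes `e`, every other
-- block except `C` contributes none, and `C` contributes fewer than `e`. The quotient by `e` is
-- thus the index of `C`.
theorem card_filter_div_eq (h : IsSortedPartition c e B P) {C : Finset α} (hC : C ∈ P)
    {a : α} (ha : a ∈ C) : (B.filter fun w => c w = c a ∧ w < a).card / e =
      ((P.erase C).filter fun D => Precedes c D C).card := by
  have h1 : (B.filter fun w => c w = c a ∧ w < a) =
      P.biUnion fun D => D.filter fun w => c w = c a ∧ w < a := by
    ext w
    simp only [Finset.mem_filter, Finset.mem_biUnion]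
    constructor
    · rintro ⟨hw, hw'⟩
      obtain ⟨D, hD, hwD⟩ := h.exists_mem w hw
      exact ⟨D, hD, hwD, hw'⟩
    · rintro ⟨D, hD, hwD, hw'⟩
      exact ⟨h.subset D hD hwD, hw'⟩
  have h2 : (C.filter fun w => c w = c a ∧ w < a).card < e := by
    rw [← h.card_eq C hC (c a)]
    refine Finset.card_lt_card (Finset.ssubset_iff_of_subset ?_ |>.2 ⟨a, ?_, ?_⟩)
    · exact Finset.monotone_filter_right _ fun _ _ hw => hw.1
    · exact Finset.mem_filter.2 ⟨ha, rfl⟩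
    · exact fun hw => (Finset.mem_filter.1 hw).2.2.false
  have h3 : ∀ D ∈ P.erase C, (D.filter fun w => c w = c a ∧ w < a).card =
      if Precedes c D C then e else 0 := by
    intro D hD
    obtain ⟨hDC, hD⟩ := Finset.mem_erase.1 hD
    split_ifs with hlt
    · rw [← h.card_eq D hD (c a)]
      congr 1
      exact Finset.filter_congr fun w hw => ⟨fun h => h.1, fun h => ⟨h, hlt w hw a ha h⟩⟩
    · rw [Finset.card_eq_zero, Finset.filter_eq_empty_iff]
      rintro w hw ⟨hwa, hlt'⟩
      exact ((h.total D hD C hC hDC).resolve_left hlt a ha w hw hwa.symm).not_gt hlt'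
  rw [h1, Finset.card_biUnion, ← Finset.add_sum_erase P _ hC, Finset.sum_congr rfl h3,
    ← Finset.sum_filter, Finset.sum_const, smul_eq_mul, Nat.add_mul_div_right _ _ (by omega),
    Nat.div_eq_of_lt h2, zero_add]
  exact fun D hD E hE hDE => Finset.disjoint_filter_filter (h.disjoint D hD E hE hDE)

theorem exists_mem_colour (h : IsSortedPartition c e B P) (he : 0 < e) {C : Finset α}
    (hC : C ∈ P) (j : κ) : ∃ a ∈ C, c a = j := by
  have := h.card_eq C hC j
  rw [← this, Finset.card_pos] at he
  obtain ⟨a, ha⟩ := he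
  exact ⟨a, Finset.mem_filter.1 ha⟩

open Classical in
theorem card_lt_of_precedes [Nonempty κ] (h : IsSortedPartition c e B P) (he : 0 < e)
    {C D : Finset α} (hC : C ∈ P) (hD : D ∈ P) (hCD : C ≠ D) (hlt : Precedes c C D) :
    ((P.erase C).filter fun E => Precedes c E C).card <
      ((P.erase D).filter fun E => Precedes c E D).card := by
  refine Finset.card_lt_card (Finset.ssubset_iff_of_subset ?_ |>.2 ⟨C, ?_, ?_⟩)
  · intro E hE
    simp only [Finset.mem_filter, Finset.mem_erase] at hE ⊢
    refine ⟨⟨?_, hE.1.2⟩, fun u hu v hv huv => ?_⟩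
    · rintro rfl
      obtain ⟨j⟩ := ‹Nonempty κ›
      obtain ⟨u, hu, hj⟩ := h.exists_mem_colour he hC j
      obtain ⟨v, hv, hj'⟩ := h.exists_mem_colour he hD j
      exact (hlt u hu v hv (hj.trans hj'.symm)).asymm (hE.2 v hv u hu (hj'.trans hj.symm))
    · obtain ⟨w, hw, hwu⟩ := h.exists_mem_colour he hC (c u)
      exact (hE.2 u hu w hw hwu.symm).trans (hlt w hw v hv (hwu.trans huv))
  · simp [hC, hCD, hlt]
  · simp

/-- Distinct blocks have distinct indices. The right-hand side does not mention `P`, which gives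
uniqueness. -/
theorem mem_iff [Nonempty κ] (h : IsSortedPartition c e B P) (he : 0 < e) {C : Finset α}
    (hC : C ∈ P) {a w : α} (ha : a ∈ C) (hw : w ∈ B) :
    w ∈ C ↔ (B.filter fun v => c v = c w ∧ v < w).card / e =
      (B.filter fun v => c v = c a ∧ v < a).card / e := by
  obtain ⟨D, hD, hwD⟩ := h.exists_mem w hw
  rw [h.card_filter_div_eq hC ha, h.card_filter_div_eq hD hwD]
  by_cases hCD : C = D
  · subst hCD
    simp [hwD]
  · refine iff_of_false (fun hwC => Finset.disjoint_left.1 (h.disjoint C hC D hD hCD) hwC hwD) ?_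
    rcases h.total C hC D hD hCD with hlt | hlt
    · exact (h.card_lt_of_precedes he hC hD hCD hlt).ne'
    · exact (h.card_lt_of_precedes he hD hC (Ne.symm hCD) hlt).ne

theorem parts_subset [Nonempty κ] (h : IsSortedPartition c e B P) (h' : IsSortedPartition c e B P')
    (he : 0 < e) : P ⊆ P' := by
  intro C hC
  obtain ⟨a, ha, -⟩ := h.exists_mem_colour he hC (Classical.arbitrary κ)
  obtain ⟨C', hC', ha'⟩ := h'.exists_mem a (h.subset C hC ha)
  suffices C = C' by rwa [this]
  ext w
  by_cases hw : w ∈ B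
  · rw [h.mem_iff he hC ha hw, h'.mem_iff he hC' ha' hw]
  · exact iff_of_false (fun h1 => hw (h.subset C hC h1)) (fun h1 => hw (h'.subset C' hC' h1))

end IsSortedPartition

end SortedPartition

/-! ### Relabelling and swapping elements of uniform prepartitions -/

namespace GPrepartition

variable {n r : ℕ}

/-- The prepartition `X` with another labelling. -/
def relabel {G : Type*} (X : GPrepartition n G) (l : Fin n → G) : GPrepartition n G :=
  ⟨X.zero, X.part, l⟩

theorem mk_relabel {G : Type*} [AddGroup G] (X : GPrepartition n G) (l : Fin n → G)
    (hl : ∀ C ∈ X.part.parts, ∃ g, ∀ a ∈ C, l a = X.label a + g) :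
    GPartition.mk (X.relabel l) = GPartition.mk X := by
  refine GPartition.mk_eq_mk_iff.2 ⟨⟨subset_rfl, fun C hC => ?_⟩, ⟨subset_rfl, fun C hC => ?_⟩⟩
  · obtain ⟨g, hg⟩ := hl C hC
    exact Or.inr ⟨C, hC, subset_rfl, -g, fun a ha => by
      change _ = l a + -g
      rw [hg a ha, add_neg_cancel_right]⟩
  · obtain ⟨g, hg⟩ := hl C hC
    exact Or.inr ⟨C, hC, subset_rfl, g, hg⟩

/-- All blocks have cardinality `d`, and the nonzero blocks are balanced. -/
def IsUniform (d k : ℕ) (X : GPrepartition n (ZMod r)) : Prop :=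
  X.zero.card = d ∧ ∀ B ∈ X.part.parts, B.card = d ∧ IsBalanced k X.label B

theorem IsUniform.relabel {d k : ℕ} (hkr : k ∣ r) {X : GPrepartition n (ZMod r)}
    (h : X.IsUniform d k) (l : Fin n → ZMod r)
    (hl : ∀ C ∈ X.part.parts, ∃ g, ∀ a ∈ C, l a = X.label a + g) :
    (X.relabel l).IsUniform d k := by
  refine ⟨h.1, fun B hB => ⟨(h.2 B hB).1, ?_⟩⟩
  obtain ⟨g, hg⟩ := hl B hB
  exact (h.2 B hB).2.of_translate hkr g hg

/-- Apply a permutation to the blocks of `X` without changing the labels. -/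
def permute {G : Type*} (X : GPrepartition n G) (σ : Equiv.Perm (Fin n)) : GPrepartition n G :=
  ofParts (X.zero.map σ.toEmbedding)
    (X.part.parts.map (Finset.mapEmbedding σ.toEmbedding).toEmbedding) X.label
    (fun a => by
      simp only [Finset.mem_map_equiv, Finset.forall_mem_map, RelEmbedding.coe_toEmbedding,
        Finset.mapEmbedding_apply]
      constructor
      · exact fun h C hC h' => X.notMem_zero_of_mem hC h' h
      · intro h
        by_contra hb
        obtain ⟨C, hC, haC⟩ := X.exists_mem_parts hb
        exact h C hC haC)
    (by
      simp only [Finset.mem_map_equiv, Finset.forall_mem_map, RelEmbedding.coe_toEmbedding,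
        Finset.mapEmbedding_apply]
      intro B hB C hC a ha ha'
      rw [X.part.eq_of_mem_parts hB hC ha ha'])
    (by
      simp only [Finset.mem_map, RelEmbedding.coe_toEmbedding, Finset.mapEmbedding_apply,
        Finset.map_eq_empty, exists_eq_right]
      exact X.part.empty_notMem_parts)

theorem mem_parts_permute {G : Type*} (X : GPrepartition n G) (σ : Equiv.Perm (Fin n))
    {B : Finset (Fin n)} : B ∈ (X.permute σ).part.parts ↔
      ∃ C ∈ X.part.parts, C.map σ.toEmbedding = B :=
  Finset.mem_map

/-- The labels stay attached to the elements of `[n]` while the blocks move, so swapping two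
elements of equal colour preserves all colour counts. -/
theorem IsUniform.permute {d k : ℕ} {X : GPrepartition n (ZMod r)} (h : X.IsUniform d k)
    {u v : Fin n} (huv : ((X.label u).cast : ZMod k) = (X.label v).cast) :
    (X.permute (Equiv.swap u v)).IsUniform d k := by
  refine ⟨(Finset.card_map _).trans h.1, fun B hB => ?_⟩
  obtain ⟨C, hC, rfl⟩ := (X.mem_parts_permute _).1 hB
  refine ⟨(Finset.card_map _).trans (h.2 C hC).1, ?_⟩
  have hσ : ∀ a, ((X.label (Equiv.swap u v a)).cast : ZMod k) = (X.label a).cast := by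
    intro a
    rw [Equiv.swap_apply_def]
    split_ifs with h1 h2
    · rw [h1, huv]
    · rw [h2, huv]
    · rfl
  have key : ∀ i : ZMod k, ((C.map (Equiv.swap u v).toEmbedding).filter
      fun a => ((X.label a).cast : ZMod k) = i).card =
      (C.filter fun a => ((X.label a).cast : ZMod k) = i).card := by
    intro i
    rw [Finset.filter_map, Finset.card_map]
    congr 1
    exact Finset.filter_congr fun a _ => by simp [hσ]
  intro i j
  exact (key i).trans (((h.2 C hC).2 i j).trans (key j).symm)

theorem permute_refines {G : Type*} [AddGroup G] {X Z : GPrepartition n G} (h : X.Refines Z)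
    (hl : ∀ a, Z.label a = X.label a) {u v : Fin n}
    (huv : u ∈ Z.zero ∧ v ∈ Z.zero ∨ ∃ D ∈ Z.part.parts, u ∈ D ∧ v ∈ D) :
    (X.permute (Equiv.swap u v)).Refines Z := by
  have hswap : ∀ S C : Finset (Fin n), C ⊆ S → (u ∈ S ↔ v ∈ S) →
      C.map (Equiv.swap u v).toEmbedding ⊆ S := by
    intro S C hCS huv a ha
    rw [Finset.mem_map_equiv, Equiv.symm_swap, Equiv.swap_apply_def] at ha
    split_ifs at ha with h1 h2
    · exact h1 ▸ huv.2 (hCS ha)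
    · exact h2 ▸ huv.1 (hCS ha)
    · exact hCS ha
  have hzero : u ∈ Z.zero ↔ v ∈ Z.zero := by
    rcases huv with h | ⟨D, hD, hu, hv⟩
    · exact iff_of_true h.1 h.2
    · exact iff_of_false (Z.notMem_zero_of_mem hD hu) (Z.notMem_zero_of_mem hD hv)
  have hpart : ∀ E ∈ Z.part.parts, u ∈ E ↔ v ∈ E := by
    intro E hE
    rcases huv with h | ⟨D, hD, hu, hv⟩
    · exact iff_of_false (fun h' => Z.notMem_zero_of_mem hE h' h.1)
        (fun h' => Z.notMem_zero_of_mem hE h' h.2)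
    · exact ⟨fun h => Z.part.eq_of_mem_parts hD hE hu h ▸ hv,
        fun h => Z.part.eq_of_mem_parts hD hE hv h ▸ hu⟩
  refine ⟨hswap _ _ h.1 hzero, fun B hB => ?_⟩
  obtain ⟨C, hC, rfl⟩ := (X.mem_parts_permute _).1 hB
  refine (h.2 C hC).imp (fun h => hswap _ _ h hzero) ?_
  rintro ⟨D, hD, hCD, -⟩
  exact ⟨D, hD, hswap _ _ hCD (hpart D hD), 0, fun a _ => (hl a).trans (add_zero _).symm⟩

end GPrepartition

/-! ### The key of an atom and its growth under swaps -/

namespace GPartition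

variable {n : ℕ} {G : Type*} [AddGroup G]

/-- The sum of the squares of the sums of the nonzero blocks. -/
def sumSq (x : GPartition n G) : ℕ := ∑ B ∈ x.parts, (∑ a ∈ B, (a : ℕ)) ^ 2

/-- The gains of `x` inside `B`. -/
def gains (x : GPartition n G) (B : Finset (Fin n)) : Set (Fin n × Fin n × G) :=
  {p | p.1 ∈ B ∧ p.2.1 ∈ B ∧ Sum.inr p ∈ x.edges}

/-- The function by which atoms are ordered; `ι` is an enumeration of the sets of gains. -/
def key (ι : Set (Fin n × Fin n × G) → ℕ) (x : GPartition n G) : ℕ ×ₗ ℕ :=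
  toLex (x.sumSq, ∑ B ∈ x.parts, ι (x.gains B))

theorem mem_gains_mk (X : GPrepartition n G) {B : Finset (Fin n)} (hB : B ∈ X.part.parts)
    (a b : Fin n) (g : G) :
    (a, b, g) ∈ (mk X).gains B ↔ a ∈ B ∧ b ∈ B ∧ X.label a - X.label b = g := by
  refine and_congr_right fun ha => and_congr_right fun hb => ?_
  constructor
  · rintro (h | ⟨C, hC, haC, -, h⟩)
    · exact absurd h.1 (X.notMem_zero_of_mem hB ha)
    · exact h
  · exact fun h => Or.inr ⟨B, hB, ha, hb, h⟩

theorem sum_swap_eq {C : Finset (Fin n)} {u v : Fin n} (huv : u ∈ C ↔ v ∈ C) :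
    ∑ a ∈ C, ((Equiv.swap u v a : Fin n) : ℕ) = ∑ a ∈ C, (a : ℕ) := by
  refine Finset.sum_equiv (Equiv.swap u v) (fun a => ?_) (fun _ _ => rfl)
  rw [Equiv.swap_apply_def]
  split_ifs with h1 h2
  · rw [h1, huv]
  · rw [h2, huv]
  · rfl

theorem sum_swap_add {C : Finset (Fin n)} {u v : Fin n} (hu : u ∈ C) (hv : v ∉ C) :
    ∑ a ∈ C, ((Equiv.swap u v a : Fin n) : ℕ) + u = ∑ a ∈ C, (a : ℕ) + v := by
  rw [← Finset.add_sum_erase C _ hu, ← Finset.add_sum_erase C _ hu, Equiv.swap_apply_left,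
    Finset.sum_congr rfl (g := fun a : Fin n => (a : ℕ))]
  · ring
  · intro a ha
    rw [Equiv.swap_apply_of_ne_of_ne (Finset.ne_of_mem_erase ha)]
    rintro rfl
    exact hv (Finset.mem_of_mem_erase ha)

theorem sumSq_permute (X : GPrepartition n G) (σ : Equiv.Perm (Fin n)) :
    (mk (X.permute σ)).sumSq = ∑ B ∈ X.part.parts, (∑ a ∈ B, ((σ a : Fin n) : ℕ)) ^ 2 := by
  change ∑ B ∈ X.part.parts.map _, _ = _
  rw [Finset.sum_map]
  refine Finset.sum_congr rfl fun B _ => ?_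
  rw [RelEmbedding.coe_toEmbedding, Finset.mapEmbedding_apply, Finset.sum_map]
  rfl

/-- The zero block does not contribute to `sumSq`, so moving the larger element into `C` is a gain.
-/
theorem sumSq_lt_of_mem_zero (X : GPrepartition n G) {C : Finset (Fin n)}
    (hC : C ∈ X.part.parts) {u v : Fin n} (hu : u ∈ X.zero) (hv : v ∈ C) (hvu : v < u) :
    (mk X).sumSq < (mk (X.permute (Equiv.swap u v))).sumSq := by
  have huD : ∀ D ∈ X.part.parts, u ∉ D := fun D hD h => X.notMem_zero_of_mem hD h hu
  rw [sumSq_permute, sumSq, parts_mk, ← Finset.add_sum_erase _ _ hC, ← Finset.add_sum_erase _ _ hC]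
  refine add_lt_add_of_lt_of_le ?_ (Finset.sum_le_sum fun D hD => ?_)
  · have h1 := sum_swap_add hv (huD C hC)
    rw [Equiv.swap_comm] at h1
    have h2 : (v : ℕ) < u := hvu
    exact Nat.pow_lt_pow_left (by omega) two_ne_zero
  · obtain ⟨hDC, hD⟩ := Finset.mem_erase.1 hD
    rw [sum_swap_eq (iff_of_false (huD D hD) fun h => hDC (X.part.eq_of_mem_parts hD hC h hv))]

/-- The swap moves a positive amount from the smaller block sum to the larger one, which increases
the sum of their squares. -/
theorem sumSq_lt_of_mem_parts (X : GPrepartition n G) {C D : Finset (Fin n)}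
    (hC : C ∈ X.part.parts) (hD : D ∈ X.part.parts) (hCD : C ≠ D)
    (hsum : ∑ a ∈ C, (a : ℕ) ≤ ∑ a ∈ D, (a : ℕ)) {u v : Fin n} (hu : u ∈ C) (hv : v ∈ D)
    (hvu : v < u) : (mk X).sumSq < (mk (X.permute (Equiv.swap u v))).sumSq := by
  have hD' : D ∈ X.part.parts.erase C := Finset.mem_erase.2 ⟨hCD.symm, hD⟩
  have hdis := X.disjoint_parts hC hD hCD
  rw [sumSq_permute, sumSq, parts_mk, ← Finset.add_sum_erase _ _ hC, ← Finset.add_sum_erase _ _ hC,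
    ← Finset.add_sum_erase _ _ hD', ← Finset.add_sum_erase _ _ hD', ← add_assoc, ← add_assoc]
  refine add_lt_add_of_lt_of_le ?_ (Finset.sum_le_sum fun E hE => ?_)
  · have h1 := sum_swap_add hu (Finset.disjoint_right.1 hdis hv)
    have h2 := sum_swap_add hv (Finset.disjoint_left.1 hdis hu)
    rw [Equiv.swap_comm] at h2
    have h3 : (v : ℕ) < u := hvu
    generalize ∑ a ∈ C, (a : ℕ) = s at *
    generalize ∑ a ∈ D, (a : ℕ) = t at *
    generalize ∑ a ∈ C, ((Equiv.swap u v a : Fin n) : ℕ) = s' at *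
    generalize ∑ a ∈ D, ((Equiv.swap u v a : Fin n) : ℕ) = t' at *
    obtain ⟨δ, hδ⟩ := Nat.exists_eq_add_of_lt h3
    have h4 : s = s' + (δ + 1) := by omega
    have h5 : t' = t + (δ + 1) := by omega
    subst h4 h5
    nlinarith
  · simp only [Finset.mem_erase] at hE
    rw [sum_swap_eq (iff_of_false (fun h => hE.2.1 (X.part.eq_of_mem_parts hE.2.2 hC h hu))
      fun h => hE.1 (X.part.eq_of_mem_parts hE.2.2 hD h hv))]

end GPartition

/-! ### Uniqueness of the local maximum -/

namespace GPartition

variable {n r d k : ℕ}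

/-- No uniform `G`-partition below a cover of `a` in `[a, y]` has a larger key than `a`. -/
def IsLocalMax (ι : Set (Fin n × Fin n × ZMod r) → ℕ) (d k : ℕ) (a y : GPartition n (ZMod r)) :
    Prop :=
  ∀ z, Merge a z → z ≤ y → ∀ W : GPrepartition n (ZMod r), W.IsUniform d k → mk W ≤ z →
    key ι (mk W) ≤ key ι a

variable {ι : Set (Fin n × Fin n × ZMod r) → ℕ} {A A' Y : GPrepartition n (ZMod r)}

theorem key_le_iff {x y : GPartition n (ZMod r)} : key ι x ≤ key ι y ↔
    x.sumSq < y.sumSq ∨ x.sumSq = y.sumSq ∧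
      ∑ B ∈ x.parts, ι (x.gains B) ≤ ∑ B ∈ y.parts, ι (y.gains B) :=
  Prod.Lex.toLex_le_toLex

theorem IsLocalMax.sumSq_le {a y z : GPartition n (ZMod r)} (h : IsLocalMax ι d k a y)
    (hz : Merge a z) (hzy : z ≤ y) {W : GPrepartition n (ZMod r)} (hW : W.IsUniform d k)
    (hWz : mk W ≤ z) : (mk W).sumSq ≤ a.sumSq :=
  (key_le_iff.1 (h z hz hzy W hW hWz)).elim le_of_lt fun h => h.1.le

theorem IsLocalMax.lt_of_mem_zero (hkr : k ∣ r) (h : IsLocalMax ι d k (mk A) (mk Y))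
    (hA : A.IsUniform d k) (hAY : A.Refines Y) {C : Finset (Fin n)} (hC : C ∈ A.part.parts)
    (hCY : C ⊆ Y.zero) {u v : Fin n} (hu : u ∈ A.zero) (hv : v ∈ C) : u < v := by
  have hne : u ≠ v := fun e => A.notMem_zero_of_mem hC hv (e ▸ hu)
  by_contra hlt
  have hvu : v < u := lt_of_le_of_ne (not_lt.1 hlt) hne.symm
  -- The label of `u` in the zero block is immaterial, so it may be given the label of `v`; the swap
  -- then preserves balance.
  have hl : ∀ E ∈ A.part.parts, ∃ g, ∀ a ∈ E,
      Function.update A.label u (A.label v) a = A.label a + g := by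
    refine fun E hE => ⟨0, fun a ha => ?_⟩
    rw [Function.update_of_ne, add_zero]
    rintro rfl
    exact A.notMem_zero_of_mem hE ha hu
  have hmk := A.mk_relabel _ hl
  set X := A.relabel (Function.update A.label u (A.label v)) with hX
  have hCX : C ∈ X.part.parts := hC
  have hXY : X.Refines Y := mk_le_mk_iff.1 (hmk ▸ mk_le_mk_iff.2 hAY)
  have hXZ := X.mergeZero_mergeZero C hCX
  have hcol : X.label u = X.label v := by
    change Function.update A.label u (A.label v) u = Function.update A.label u (A.label v) v
    rw [Function.update_self, Function.update_of_ne hne.symm]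
  have h1 := h.sumSq_le (hmk ▸ merge_mk (Or.inl hXZ))
    (mk_le_mk_iff.2 (GPrepartition.mergeZero_refines hXY hCX hCY))
    ((hA.relabel hkr _ hl).permute (u := u) (v := v) (by rw [← hX, hcol]))
    (mk_le_mk_iff.2 (GPrepartition.permute_refines hXZ.refines (fun _ => rfl)
      (Or.inl ⟨Finset.mem_union_left _ hu, Finset.mem_union_right _ hv⟩)))
  exact (sumSq_lt_of_mem_zero X hCX hu hv hvu).not_ge (hmk ▸ h1)

theorem IsLocalMax.lt_of_mem_parts (h : IsLocalMax ι d k (mk A) (mk Y))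
    (hA : A.IsUniform d k) (hAY : A.Refines Y) {C D : Finset (Fin n)} (hC : C ∈ A.part.parts)
    (hD : D ∈ A.part.parts) (hCD : C ≠ D) (hsum : ∑ a ∈ C, (a : ℕ) ≤ ∑ a ∈ D, (a : ℕ))
    (hY : C ∪ D ⊆ Y.zero ∨ ∃ E ∈ Y.part.parts, C ∪ D ⊆ E ∧ ∀ a ∈ C ∪ D, Y.label a = A.label a)
    {u v : Fin n} (hu : u ∈ C) (hv : v ∈ D)
    (huv : ((A.label u).cast : ZMod k) = (A.label v).cast) : u < v := by
  have hne : u ≠ v := fun e => Finset.disjoint_left.1 (A.disjoint_parts hC hD hCD) hu (e ▸ hv)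
  by_contra hlt
  have hvu : v < u := lt_of_le_of_ne (not_lt.1 hlt) hne.symm
  have hAZ := A.mergeNonzero_mergeNonzero C D hC hD hCD 0
  have hZY : (A.mergeNonzero C D hC hD 0).Refines Y := by
    refine GPrepartition.mergeNonzero_refines hAY hC hD hCD (hY.imp id ?_)
    rintro ⟨E, hE, hCDE, hl⟩
    have hu' := Finset.mem_union_left D hu
    have hv' := Finset.mem_union_right C hv
    exact ⟨E, hE, u, hu, hCDE hu', v, hv, hCDE hv', by rw [hl u hu', hl v hv', add_zero]⟩
  have h1 := h.sumSq_le (merge_mk (Or.inr hAZ)) (mk_le_mk_iff.2 hZY) (hA.permute huv)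
    (mk_le_mk_iff.2 (GPrepartition.permute_refines hAZ.refines (fun a => ?_)
      (Or.inr ⟨C ∪ D, Finset.mem_insert_self _ _, Finset.mem_union_left _ hu,
        Finset.mem_union_right _ hv⟩)))
  · exact (sumSq_lt_of_mem_parts A hC hD hCD hsum hu hv hvu).not_ge h1
  · change (if a ∈ D then A.label a + 0 else A.label a) = _
    rw [add_zero, ite_self]

/-- Inside the zero block of `Y` the labels of `C` can be translated until `u` and `v` have the same
colour, so colours impose no restriction. -/
theorem IsLocalMax.lt_of_subset_zero (hkr : k ∣ r) (h : IsLocalMax ι d k (mk A) (mk Y))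
    (hA : A.IsUniform d k) (hAY : A.Refines Y) {C D : Finset (Fin n)} (hC : C ∈ A.part.parts)
    (hD : D ∈ A.part.parts) (hCD : C ≠ D) (hsum : ∑ a ∈ C, (a : ℕ) ≤ ∑ a ∈ D, (a : ℕ))
    (hCY : C ⊆ Y.zero) (hDY : D ⊆ Y.zero) {u v : Fin n} (hu : u ∈ C) (hv : v ∈ D) : u < v := by
  have hvC : v ∉ C := Finset.disjoint_right.1 (A.disjoint_parts hC hD hCD) hv
  have hl : ∀ E ∈ A.part.parts, ∃ g, ∀ a ∈ E,
      (if a ∈ C then A.label a + (A.label v - A.label u) else A.label a) = A.label a + g := by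
    intro E hE
    by_cases hEC : E = C
    · subst hEC
      exact ⟨_, fun a ha => if_pos ha⟩
    · exact ⟨0, fun a ha => by
        rw [if_neg fun h => hEC (A.part.eq_of_mem_parts hE hC ha h), add_zero]⟩
  have hmk := A.mk_relabel _ hl
  refine IsLocalMax.lt_of_mem_parts (hmk ▸ h) (hA.relabel hkr _ hl)
    (mk_le_mk_iff.1 (hmk ▸ mk_le_mk_iff.2 hAY)) hC hD hCD hsum
    (Or.inl (Finset.union_subset hCY hDY)) hu hv ?_
  change ((if u ∈ C then _ else _ : ZMod r).cast : ZMod k) = (if v ∈ C then _ else _ : ZMod r).cast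
  rw [if_pos hu, if_neg hvC, add_sub_cancel]

/-- Since colours play no role here, there is a single colour, and the `d` elements of each block
all have it. -/
theorem IsLocalMax.isSortedPartition_zero (hkr : k ∣ r) (h : IsLocalMax ι d k (mk A) (mk Y))
    (hA : A.IsUniform d k) (hAY : A.Refines Y) :
    IsSortedPartition (fun _ : Fin n => ()) d Y.zero
      (insert A.zero (A.part.parts.filter (· ⊆ Y.zero))) where
  subset C hC := by
    rcases Finset.mem_insert.1 hC with rfl | hC
    exacts [hAY.1, (Finset.mem_filter.1 hC).2]
  exists_mem a ha := by
    by_cases haA : a ∈ A.zero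
    · exact ⟨_, Finset.mem_insert_self _ _, haA⟩
    · obtain ⟨C, hC, haC⟩ := A.exists_mem_parts haA
      exact ⟨C, Finset.mem_insert_of_mem (Finset.mem_filter.2 ⟨hC,
        GPrepartition.subset_zero_of_refines hAY hC haC ha⟩), haC⟩
  disjoint := by
    simp only [Finset.forall_mem_insert, Finset.mem_filter, and_imp]
    exact ⟨⟨fun h => absurd rfl h, fun D hD _ _ => A.disjoint_zero hD⟩, fun C hC _ =>
      ⟨fun _ => (A.disjoint_zero hC).symm, fun D hD _ hCD => A.disjoint_parts hC hD hCD⟩⟩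
  card_eq := by
    simp only [Finset.forall_mem_insert, Finset.mem_filter, and_imp, Finset.filter_true,
      forall_const]
    exact ⟨hA.1, fun C hC _ => (hA.2 C hC).1⟩
  total := by
    simp only [Finset.forall_mem_insert, Finset.mem_filter, and_imp]
    refine ⟨⟨fun h => absurd rfl h, fun D hD hDY _ => Or.inl fun u hu v hv _ =>
      h.lt_of_mem_zero hkr hA hAY hD hDY hu hv⟩, fun C hC hCY => ⟨fun _ => Or.inr
      fun u hu v hv _ => h.lt_of_mem_zero hkr hA hAY hC hCY hu hv, fun D hD hDY hCD => ?_⟩⟩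
    rcases le_total (∑ a ∈ C, (a : ℕ)) (∑ a ∈ D, (a : ℕ)) with hs | hs
    · exact Or.inl fun u hu v hv _ => h.lt_of_subset_zero hkr hA hAY hC hD hCD hs hCY hDY hu hv
    · exact Or.inr fun u hu v hv _ =>
        h.lt_of_subset_zero hkr hA hAY hD hC hCD.symm hs hDY hCY hu hv

theorem IsLocalMax.isSortedPartition_parts [NeZero k] {e : ℕ} (hd : d = k * e)
    (h : IsLocalMax ι d k (mk A) (mk Y)) (hA : A.IsUniform d k) (hAY : A.Refines Y)
    (hl : ∀ a ∉ Y.zero, A.label a = Y.label a) {B : Finset (Fin n)} (hB : B ∈ Y.part.parts) :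
    IsSortedPartition (fun a => ((Y.label a).cast : ZMod k)) e B
      (A.part.parts.filter (· ⊆ B)) := by
  have hl' : ∀ a ∈ B, A.label a = Y.label a := fun a ha => hl a (Y.notMem_zero_of_mem hB ha)
  refine ⟨fun C hC => (Finset.mem_filter.1 hC).2, fun a ha => ?_, fun C hC D hD hCD => ?_,
    fun C hC j => ?_, fun C hC D hD hCD => ?_⟩
  · have haY := Y.notMem_zero_of_mem hB ha
    obtain ⟨C, hC, haC⟩ := A.exists_mem_parts fun h => haY (hAY.1 h)
    rcases hAY.2 C hC with h1 | ⟨E, hE, hCE, -⟩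
    · exact absurd (h1 haC) haY
    · rw [Y.part.eq_of_mem_parts hE hB (hCE haC) ha] at hCE
      exact ⟨C, Finset.mem_filter.2 ⟨hC, hCE⟩, haC⟩
  · exact A.disjoint_parts (Finset.mem_filter.1 hC).1 (Finset.mem_filter.1 hD).1 hCD
  · obtain ⟨hC, hCB⟩ := Finset.mem_filter.1 hC
    have h1 := ((hA.2 C hC).2.congr (l' := Y.label) fun a ha => by
      rw [hl' a (hCB ha)]).card_eq j
    rw [(hA.2 C hC).1, hd] at h1
    exact (Nat.eq_of_mul_eq_mul_left (NeZero.pos k) h1).symm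
  · obtain ⟨hC, hCB⟩ := Finset.mem_filter.1 hC
    obtain ⟨hD, hDB⟩ := Finset.mem_filter.1 hD
    have key : ∀ C ∈ A.part.parts, ∀ D ∈ A.part.parts, C ⊆ B → D ⊆ B → C ≠ D →
        ∑ a ∈ C, (a : ℕ) ≤ ∑ a ∈ D, (a : ℕ) →
        Precedes (fun a => ((Y.label a).cast : ZMod k)) C D := by
      intro C hC D hD hCB hDB hCD hs u hu v hv huv
      refine h.lt_of_mem_parts hA hAY hC hD hCD hs (Or.inr ⟨B, hB, Finset.union_subset hCB hDB,
        fun a ha => (hl' a (Finset.union_subset hCB hDB ha)).symm⟩) hu hv ?_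
      rw [hl' u (hCB hu), hl' v (hDB hv)]
      exact huv
    exact (le_total _ _).imp (key C hC D hD hCB hDB hCD) (key D hD C hC hDB hCB hCD.symm)

/-- Replacing the labels of `A` on `C` by those of `A'` stays below the merge of `C` into the zero
block. It leaves `sumSq` and the gains of the other blocks unchanged, so only the terms at `C` are
compared. -/
theorem IsLocalMax.enum_gains_le (h : IsLocalMax ι d k (mk A) (mk Y)) (hA : A.IsUniform d k)
    (hA' : A'.IsUniform d k) (hAY : A.Refines Y) {C : Finset (Fin n)} (hC : C ∈ A.part.parts)
    (hC' : C ∈ A'.part.parts) (hCY : C ⊆ Y.zero) :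
    ι ((mk A').gains C) ≤ ι ((mk A).gains C) := by
  let W := A.relabel fun a => if a ∈ C then A'.label a else A.label a
  have hother : ∀ E ∈ A.part.parts, E ≠ C → ∀ a ∈ E, W.label a = A.label a :=
    fun E hE hEC a ha => if_neg fun h => hEC (A.part.eq_of_mem_parts hE hC ha h)
  have hself : ∀ a ∈ C, W.label a = A'.label a := fun a ha => if_pos ha
  have hW : W.IsUniform d k := by
    refine ⟨hA.1, fun E hE => ⟨(hA.2 E hE).1, ?_⟩⟩
    by_cases hEC : E = C
    · subst hEC
      exact (hA'.2 E hC').2.congr fun a ha => by rw [hself a ha]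
    · exact (hA.2 E hE).2.congr fun a ha => by rw [hother E hE hEC a ha]
  have hWZ : W.Refines (A.mergeZero C hC) := by
    refine ⟨Finset.subset_union_left, fun E hE => ?_⟩
    by_cases hEC : E = C
    · exact Or.inl (hEC ▸ Finset.subset_union_right)
    · exact Or.inr ⟨E, Finset.mem_erase.2 ⟨hEC, hE⟩, subset_rfl, 0, fun a ha => by
        rw [hother E hE hEC a ha, add_zero]
        rfl⟩
  have h1 := h _ (merge_mk (Or.inl (A.mergeZero_mergeZero C hC)))
    (mk_le_mk_iff.2 (GPrepartition.mergeZero_refines hAY hC hCY)) W hW (mk_le_mk_iff.2 hWZ)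
  have hsq : (mk W).sumSq = (mk A).sumSq := rfl
  have h2 : ∑ B ∈ A.part.parts, ι ((mk W).gains B) ≤ ∑ B ∈ A.part.parts, ι ((mk A).gains B) :=
    (key_le_iff.1 h1).elim (fun h => absurd hsq h.ne) fun h => h.2
  rw [← Finset.add_sum_erase _ _ hC, ← Finset.add_sum_erase _ _ hC] at h2
  have h3 : (mk W).gains C = (mk A').gains C := by
    ext ⟨a, b, g⟩
    rw [mem_gains_mk W hC, mem_gains_mk A' hC']
    exact and_congr_right fun ha => and_congr_right fun hb => by rw [hself a ha, hself b hb]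
  have h4 : ∀ E ∈ A.part.parts.erase C, ι ((mk W).gains E) = ι ((mk A).gains E) := by
    intro E hE
    obtain ⟨hEC, hE⟩ := Finset.mem_erase.1 hE
    congr 1
    ext ⟨a, b, g⟩
    rw [mem_gains_mk W hE, mem_gains_mk A hE]
    exact and_congr_right fun ha => and_congr_right fun hb => by
      rw [hother E hE hEC a ha, hother E hE hEC b hb]
  rw [Finset.sum_congr rfl h4, h3] at h2
  exact le_of_add_le_add_right h2

/-- Both sorted partitions of the zero block of `Y` have the same blocks. Were the two zero blocks
different, each would be a nonzero block of the other prepartition, and each would precede the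
other. -/
theorem IsLocalMax.zero_eq (hd : 0 < d) (hkr : k ∣ r) (h : IsLocalMax ι d k (mk A) (mk Y))
    (h' : IsLocalMax ι d k (mk A') (mk Y)) (hA : A.IsUniform d k) (hA' : A'.IsUniform d k)
    (hAY : A.Refines Y) (hAY' : A'.Refines Y) : A.zero = A'.zero := by
  have hs := h.isSortedPartition_zero hkr hA hAY
  have hs' := h'.isSortedPartition_zero hkr hA' hAY'
  obtain ⟨a, ha⟩ : A.zero.Nonempty := Finset.card_pos.1 (hA.1 ▸ hd)
  obtain ⟨b, hb⟩ : A'.zero.Nonempty := Finset.card_pos.1 (hA'.1 ▸ hd)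
  rcases Finset.mem_insert.1 (hs.parts_subset hs' hd (Finset.mem_insert_self _ _)) with h1 | h1
  · exact h1
  · rcases Finset.mem_insert.1 (hs'.parts_subset hs hd (Finset.mem_insert_self _ _)) with h2 | h2
    · exact h2.symm
    · rw [Finset.mem_filter] at h1 h2
      exact ((h.lt_of_mem_zero hkr hA hAY h2.1 h2.2 ha hb).asymm
        (h'.lt_of_mem_zero hkr hA' hAY' h1.1 h1.2 hb ha)).elim

theorem IsLocalMax.parts_subset (hd : 0 < d) (hkr : k ∣ r) (hkd : k ∣ d)
    (h : IsLocalMax ι d k (mk A) (mk Y)) (h' : IsLocalMax ι d k (mk A') (mk Y))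
    (hA : A.IsUniform d k) (hA' : A'.IsUniform d k) (hAY : A.Refines Y) (hAY' : A'.Refines Y)
    (hl : ∀ a ∉ Y.zero, A.label a = Y.label a) (hl' : ∀ a ∉ Y.zero, A'.label a = Y.label a) :
    A.part.parts ⊆ A'.part.parts := by
  intro C hC
  obtain ⟨e, he⟩ := hkd
  have hk : NeZero k := ⟨fun e => by subst e; omega⟩
  have he' : 0 < e := Nat.pos_of_ne_zero fun h => by subst h; omega
  rcases hAY.2 C hC with hCY | ⟨B, hB, hCB, -⟩
  · have h1 := (h.isSortedPartition_zero hkr hA hAY).parts_subset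
      (h'.isSortedPartition_zero hkr hA' hAY') hd
      (Finset.mem_insert_of_mem (Finset.mem_filter.2 ⟨hC, hCY⟩))
    rcases Finset.mem_insert.1 h1 with h1 | h1
    · rw [← h.zero_eq hd hkr h' hA hA' hAY hAY'] at h1
      obtain ⟨c, hc⟩ := A.part.nonempty_of_mem_parts hC
      exact absurd (h1 ▸ hc) (A.notMem_zero_of_mem hC hc)
    · exact (Finset.mem_filter.1 h1).1
  · exact (Finset.mem_filter.1 ((h.isSortedPartition_parts he hA hAY hl hB).parts_subset
      (h'.isSortedPartition_parts he hA' hAY' hl' hB) he' (Finset.mem_filter.2 ⟨hC, hCB⟩))).1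

theorem IsLocalMax.refines (hι : Function.Injective ι) (hd : 0 < d) (hkr : k ∣ r) (hkd : k ∣ d)
    (h : IsLocalMax ι d k (mk A) (mk Y)) (h' : IsLocalMax ι d k (mk A') (mk Y))
    (hA : A.IsUniform d k) (hA' : A'.IsUniform d k) (hAY : A.Refines Y) (hAY' : A'.Refines Y)
    (hl : ∀ a ∉ Y.zero, A.label a = Y.label a) (hl' : ∀ a ∉ Y.zero, A'.label a = Y.label a) :
    A.Refines A' := by
  refine ⟨(h.zero_eq hd hkr h' hA hA' hAY hAY').subset, fun C hC => Or.inr ?_⟩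
  have hC' := h.parts_subset hd hkr hkd h' hA hA' hAY hAY' hl hl' hC
  refine ⟨C, hC', subset_rfl, ?_⟩
  obtain ⟨c, hc⟩ := A.part.nonempty_of_mem_parts hC
  by_cases hcY : c ∈ Y.zero
  · have hCY := GPrepartition.subset_zero_of_refines hAY hC hc hcY
    have hg : (mk A).gains C = (mk A').gains C :=
      hι ((h'.enum_gains_le hA' hA hAY' hC' hC hCY).antisymm
        (h.enum_gains_le hA hA' hAY hC hC' hCY))
    refine ⟨A'.label c - A.label c, fun a ha => ?_⟩
    have h1 : (a, c, A.label a - A.label c) ∈ (mk A').gains C :=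
      hg ▸ (mem_gains_mk A hC _ _ _).2 ⟨ha, hc, rfl⟩
    have h2 := ((mem_gains_mk A' hC' _ _ _).1 h1).2.2
    rw [sub_eq_iff_eq_add] at h2
    rw [h2]
    ring
  · refine ⟨0, fun a ha => ?_⟩
    have haY : a ∉ Y.zero := fun h =>
      hcY (GPrepartition.subset_zero_of_refines hAY hC ha h hc)
    rw [add_zero, hl a haY, hl' a haY]

/-- Normalises a representative so that its labels agree with `Y` off the zero block; two local
maxima then become comparable label by label there. -/
theorem exists_relabel_of_refines {G : Type*} [AddGroup G] {A Y : GPrepartition n G}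
    (h : A.Refines Y) : ∃ l : Fin n → G, (∀ a ∉ Y.zero, l a = Y.label a) ∧
      ∀ C ∈ A.part.parts, ∃ g, ∀ a ∈ C, l a = A.label a + g := by
  refine ⟨fun a => if a ∈ Y.zero then A.label a else Y.label a, fun a ha => if_neg ha,
    fun C hC => ?_⟩
  rcases h.2 C hC with h1 | ⟨D, hD, hCD, g, hg⟩
  · exact ⟨0, fun a ha => (if_pos (h1 ha)).trans (add_zero _).symm⟩
  · exact ⟨g, fun a ha => (if_neg (Y.notMem_zero_of_mem hD (hCD ha))).trans (hg a ha)⟩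

theorem IsLocalMax.unique (hι : Function.Injective ι) (hd : 0 < d) (hkr : k ∣ r) (hkd : k ∣ d)
    (h : IsLocalMax ι d k (mk A) (mk Y)) (h' : IsLocalMax ι d k (mk A') (mk Y))
    (hA : A.IsUniform d k) (hA' : A'.IsUniform d k) (hAY : mk A ≤ mk Y) (hAY' : mk A' ≤ mk Y) :
    mk A = mk A' := by
  obtain ⟨l, hl, hlA⟩ := exists_relabel_of_refines (mk_le_mk_iff.1 hAY)
  obtain ⟨l', hl', hlA'⟩ := exists_relabel_of_refines (mk_le_mk_iff.1 hAY')
  have hB := hA.relabel hkr l hlA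
  have hB' := hA'.relabel hkr l' hlA'
  rw [← A.mk_relabel l hlA] at h hAY ⊢
  rw [← A'.mk_relabel l' hlA'] at h' hAY' ⊢
  rw [mk_le_mk_iff] at hAY hAY'
  exact mk_eq_mk_iff.2 ⟨h.refines hι hd hkr hkd h' hB hB' hAY hAY' hl hl',
    h'.refines hι hd hkr hkd h hB' hB hAY' hAY hl' hl⟩

end GPartition

/-! ### The subposet: rank, joins, covers and the atom ordering -/

namespace QnrdkJ

open GPartition

variable {n r d k : ℕ}

/-- `0̂` and `1̂` are the bounds of `Q_n(r, d, k, {0})`. -/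
@[reducible] def boundedOrder (hn : 0 < n) (hkr : k ∣ r) :
    BoundedOrder (QnrdkJ n r d k {0}) where
  top := ⟨oneHat n r, (mem_QnrdkJ_iff hkr).2 (Or.inr (isGood_oneHat hn))⟩
  le_top x := le_oneHat x.1
  bot := ⟨zeroHat n (ZMod r), (mem_QnrdkJ_iff hkr).2 (Or.inl rfl)⟩
  bot_le x := zeroHat_le x.1

theorem isGood_of_ne (hkr : k ∣ r) {x : QnrdkJ n r d k {0}} (hx : x.1 ≠ zeroHat n (ZMod r)) :
    x.1.IsGood d k :=
  ((mem_QnrdkJ_iff hkr).1 x.2).resolve_left hx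

theorem isGood_of_lt (hkr : k ∣ r) {x y : QnrdkJ n r d k {0}} (h : x < y) : y.1.IsGood d k :=
  isGood_of_ne hkr fun e => (show x.1 < y.1 from h).not_ge (e ▸ zeroHat_le x.1)

open Classical in
/-- The rank function of `Q_n(r, d, k, {0})`. -/
noncomputable def rank (x : QnrdkJ n r d k {0}) : ℕ :=
  if x.1 = zeroHat n (ZMod r) then 0 else n / d - x.1.parts.card

theorem rank_of_isGood {x : QnrdkJ n r d k {0}} (h : x.1.IsGood d k) :
    rank x = n / d - x.1.parts.card :=
  if_neg h.ne_zeroHat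

theorem strictMono_rank (hd : 0 < d) (hkr : k ∣ r) (hnd : d ∣ n) :
    StrictMono (rank : QnrdkJ n r d k {0} → ℕ) := by
  intro x y hxy
  have hy := isGood_of_lt hkr hxy
  have h1 := hy.card_parts_lt hd hnd
  rw [rank_of_isGood hy]
  by_cases hx : x.1 = zeroHat n (ZMod r)
  · rw [rank, if_pos hx]
    omega
  · have h2 := card_lt_of_lt (show x.1 < y.1 from hxy)
    have h3 := (isGood_of_ne hkr hx).card_parts_lt hd hnd
    rw [rank_of_isGood (isGood_of_ne hkr hx)]
    omega

/-- Above `0̂` one splits a block of `y`; elsewhere one takes the first merge of a chain from `x` to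
`y`. -/
theorem exists_between_of_rank (hd : 0 < d) (hkr : k ∣ r) (hkd : k ∣ d) (hnd : d ∣ n)
    (x y : QnrdkJ n r d k {0}) (hxy : x < y) (h : rank x + 1 < rank y) :
    ∃ z, x < z ∧ z < y := by
  have hy := isGood_of_lt hkr hxy
  rw [rank_of_isGood hy] at h
  by_cases hx : x.1 = zeroHat n (ZMod r)
  · obtain ⟨w, hw, hwy⟩ := hy.exists_merge hd hkr hkd hnd (by omega)
    refine ⟨⟨w, (mem_QnrdkJ_iff hkr).2 (Or.inr hw)⟩, ?_, hwy.lt⟩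
    exact lt_of_le_of_ne (show x.1 ≤ w from hx ▸ zeroHat_le w)
      fun e => hw.ne_zeroHat ((congrArg Subtype.val e).symm.trans hx)
  · have hx' := isGood_of_ne hkr hx
    rw [rank_of_isGood hx'] at h
    obtain ⟨z, hz, hzy⟩ := exists_merge_of_lt (show x.1 < y.1 from hxy)
    refine ⟨⟨z, (mem_QnrdkJ_iff hkr).2 (Or.inr (hx'.of_le hkr hz.le))⟩, hz.lt, ?_⟩
    have h1 := hz.card_eq
    exact lt_of_le_of_ne (show z ≤ y.1 from hzy) fun e => by
      have : z = y.1 := congrArg Subtype.val e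
      rw [← this] at h
      omega

theorem exists_isLUB (hkr : k ∣ r) (x y : QnrdkJ n r d k {0}) : ∃ z, IsLUB {x, y} z := by
  by_cases hx : x.1 = zeroHat n (ZMod r)
  · refine ⟨y, ?_, fun w hw => hw (by simp)⟩
    rintro w (rfl | rfl)
    exacts [(show w.1 ≤ y.1 from hx ▸ zeroHat_le y.1), le_rfl]
  · obtain ⟨z, hz⟩ := GPartition.exists_isLUB x.1 y.1
    have hxz : x.1 ≤ z := hz.1 (by simp)
    refine ⟨⟨z, (mem_QnrdkJ_iff hkr).2 (Or.inr ((isGood_of_ne hkr hx).of_le hkr hxz))⟩, ?_, ?_⟩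
    · rintro w (rfl | rfl)
      exacts [hxz, hz.1 (by simp)]
    · intro w hw
      refine hz.2 ?_
      rintro v (rfl | rfl)
      exacts [hw (a := x) (by simp), hw (a := y) (by simp)]

theorem covBy_iff_merge (hkr : k ∣ r) {x y : QnrdkJ n r d k {0}} (hx : x.1.IsGood d k) :
    x ⋖ y ↔ Merge x.1 y.1 := by
  constructor
  · intro h
    obtain ⟨z, hz, hzy⟩ := exists_merge_of_lt (show x.1 < y.1 from h.lt)
    rcases hzy.lt_or_eq with hlt | rfl
    · exact absurd hlt (h.2 (c := ⟨z, (mem_QnrdkJ_iff hkr).2 (Or.inr (hx.of_le hkr hz.le))⟩) hz.lt)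
    · exact hz
  · refine fun h => ⟨h.lt, fun z hxz hzy => ?_⟩
    have h1 := h.card_eq
    have h2 := card_lt_of_lt (show x.1 < z.1 from hxz)
    have h3 := card_lt_of_lt (show z.1 < y.1 from hzy)
    omega

theorem zeroHat_covBy_iff (hd : 0 < d) (hkr : k ∣ r) (hkd : k ∣ d) (hnd : d ∣ n)
    {x a : QnrdkJ n r d k {0}} (hx : x.1 = zeroHat n (ZMod r)) :
    x ⋖ a ↔ a.1.IsGood d k ∧ a.1.parts.card + 1 = n / d := by
  have hlt : ∀ w : QnrdkJ n r d k {0}, w.1.IsGood d k → x < w := fun w hw =>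
    lt_of_le_of_ne (show x.1 ≤ w.1 from hx ▸ zeroHat_le w.1)
      fun e => hw.ne_zeroHat ((congrArg Subtype.val e).symm.trans hx)
  constructor
  · intro h
    have ha := isGood_of_lt hkr h.lt
    refine ⟨ha, ?_⟩
    by_contra hne
    obtain ⟨w, hw, hwa⟩ := ha.exists_merge hd hkr hkd hnd hne
    exact h.2 (hlt ⟨w, (mem_QnrdkJ_iff hkr).2 (Or.inr hw)⟩ hw) hwa.lt
  · rintro ⟨ha, hcard⟩
    refine ⟨hlt a ha, fun z hxz hza => ?_⟩
    have h1 := (isGood_of_lt hkr hxz).card_parts_lt hd hnd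
    have h2 := card_lt_of_lt (show z.1 < a.1 from hza)
    omega

theorem admitsRecursiveAtomOrdering (hn : 0 < n) (hr : 0 < r) (hd : 0 < d) (hkr : k ∣ r)
    (hkd : k ∣ d) (hnd : d ∣ n) : AdmitsRecursiveAtomOrdering (QnrdkJ n r d k {0}) := by
  have : NeZero r := ⟨hr.ne'⟩
  let := boundedOrder (d := d) hn hkr
  obtain ⟨ι, hι⟩ := Countable.exists_injective_nat (Set (Fin n × Fin n × ZMod r))
  refine ⟨this, exists_isRecursiveAtomOrdering_of_isLocalMax_unique
    (fun x => key ι x.1) ?_ ?_ ?_⟩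
  · refine lt_of_le_of_ne bot_le fun e => ?_
    exact (isGood_oneHat (r := r) (d := d) (k := k) hn).ne_zeroHat (congrArg Subtype.val e).symm
  · intro w hw a b y ha hb hab hay hby
    have hw' : w.1.IsGood d k := isGood_of_ne hkr fun e => hw (Subtype.ext e)
    have ha' := (covBy_iff_merge hkr hw').1 ha
    obtain ⟨z, hz, hbz, hzy⟩ := exists_merge_of_merge_of_merge ha'
      ((covBy_iff_merge hkr hw').1 hb) (fun e => hab (Subtype.ext e)) hay.le hby.le
    have hag := hw'.of_le hkr ha'.le
    exact ⟨⟨z, (mem_QnrdkJ_iff hkr).2 (Or.inr (hag.of_le hkr hz.le))⟩,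
      (covBy_iff_merge hkr hag).2 hz, hbz, hzy⟩
  · have hatom : ∀ a : QnrdkJ n r d k {0}, ⊥ ⋖ a ↔
        a.1.IsGood d k ∧ a.1.parts.card + 1 = n / d :=
      fun a => zeroHat_covBy_iff hd hkr hkd hnd rfl
    have hrep : ∀ a : QnrdkJ n r d k {0}, ⊥ ⋖ a →
        ∃ A : GPrepartition n (ZMod r), mk A = a.1 ∧ A.IsUniform d k := by
      intro a ha
      obtain ⟨⟨A, hAa, hA⟩, hcard⟩ := (hatom a).1 ha
      rw [← hAa] at hcard
      obtain ⟨h0, h1⟩ := hA.card_eq_of_card_parts hnd hcard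
      exact ⟨A, hAa, h0, fun B hB => ⟨h1 B hB, (hA.2 B hB).2⟩⟩
    -- Uniform prepartitions represent exactly the atoms, so local maximality among atoms is
    -- `IsLocalMax`.
    have hloc : ∀ a y : QnrdkJ n r d k {0}, ⊥ ⋖ a →
        (∀ z, a ⋖ z → z ≤ y → ∀ c, ⊥ ⋖ c → c ≤ z → key ι c.1 ≤ key ι a.1) →
        IsLocalMax ι d k a.1 y.1 := by
      intro a y ha h z hz hzy W hW hWz
      have hag := ((hatom a).1 ha).1
      have hWg : W.IsGood d k := ⟨Finset.card_pos.1 (hW.1 ▸ hd),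
        fun B hB => ⟨(hW.2 B hB).1.symm.dvd, (hW.2 B hB).2⟩⟩
      refine h ⟨z, (mem_QnrdkJ_iff hkr).2 (Or.inr (hag.of_le hkr hz.le))⟩
        ((covBy_iff_merge hkr hag).2 hz) hzy
        ⟨mk W, (mem_QnrdkJ_iff hkr).2 (Or.inr ⟨W, rfl, hWg⟩)⟩ ((hatom _).2 ⟨⟨W, rfl, hWg⟩, ?_⟩) hWz
      exact GPrepartition.card_parts_of_card_eq hd hW.1 fun B hB => (hW.2 B hB).1
    intro a b y ha hb hay hby hla hlb
    obtain ⟨A, hAa, hA⟩ := hrep a ha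
    obtain ⟨B, hBb, hB⟩ := hrep b hb
    obtain ⟨Y, hY⟩ := exists_mk y.1
    have h1 := hloc a y ha hla
    have h2 := hloc b y hb hlb
    have h3 : a.1 ≤ y.1 := hay.le
    have h4 : b.1 ≤ y.1 := hby.le
    apply Subtype.ext
    rw [← hAa, ← hY] at h1 h3
    rw [← hBb, ← hY] at h2 h4
    rw [← hAa, ← hBb]
    exact h1.unique hι hd hkr hkd h2 hA hB h3 h4

end QnrdkJ

end Dowling

theorem mainTheorem4 (n r d k : ℕ) (hn : 0 < n) (hr : 0 < r) (hd : 0 < d)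
    (hkr : k ∣ r) (hkd : k ∣ d) (hnd : n ≡ 0 [MOD d]) :
    Dowling.IsLatticeOrder (Dowling.QnrdkJ n r d k {0}) ∧
    Dowling.IsPure (Dowling.QnrdkJ n r d k {0}) ∧
    Dowling.AdmitsRecursiveAtomOrdering (Dowling.QnrdkJ n r d k {0}) ∧
    ∀ x : Dowling.QnrdkJ n r d k {0},
      (x.1 = Dowling.GPartition.zeroHat n (ZMod r) → Order.height x = 0) ∧
      (x.1 ≠ Dowling.GPartition.zeroHat n (ZMod r) →
        Order.height x + (x.1.parts.card : ℕ∞) = ((n / d : ℕ) : ℕ∞)) := by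
  have hnd' : d ∣ n := (Nat.modEq_zero_iff_dvd).1 hnd
  have : NeZero r := ⟨hr.ne'⟩
  let := Dowling.QnrdkJ.boundedOrder (d := d) hn hkr
  have mono := Dowling.QnrdkJ.strictMono_rank hd hkr hnd'
  have bot : Dowling.QnrdkJ.rank (⊥ : Dowling.QnrdkJ n r d k {0}) = 0 := if_pos rfl
  have dense := Dowling.QnrdkJ.exists_between_of_rank hd hkr hkd hnd'
  refine ⟨Dowling.isLatticeOrder_of_exists_isLUB (Dowling.QnrdkJ.exists_isLUB hkr),
    Dowling.isPure_of_rank _ mono bot dense,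
    Dowling.QnrdkJ.admitsRecursiveAtomOrdering hn hr hd hkr hkd hnd', fun x => ?_⟩
  rw [Dowling.height_eq_of_rank _ mono bot dense]
  refine ⟨fun h => by rw [Dowling.QnrdkJ.rank, if_pos h]; rfl, fun h => ?_⟩
  have hx := Dowling.QnrdkJ.isGood_of_ne hkr h
  have h1 := hx.card_parts_lt hd hnd'
  -- The truncated subtraction is exact, since `h1` bounds the number of blocks by `n / d - 1`.
  rw [Dowling.QnrdkJ.rank_of_isGood hx, ← Nat.cast_add, Nat.sub_add_cancel (by omega)]
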